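/- **Lemma 3.1.** For $u\in\mathbb R^5$ and $v\in\mathbb N^5$ (where $0\in\mathbb N$) write $u\cdot v=\sum_{i=1}^5u_iv_i$. - A set $\mathcal X\subseteq\mathbb N^5$ is *good* if for every $u\in\mathbb R^5$ with $\sum_{i=1}^5u_i=0$, either $u\cdot v=0$ for every $v\in\mathcal X$, or there are $v,v'\in\mathcal X$ with $u\cdot v<0<u\cdot v'$. - For $V\subseteq\mathbb N^5$, let $\operatorname{Compat}(V)$ be the set of all $w\in\mathbb N^5$ such that $(w,2)\in\mathbb R^6$ lies in the real linear span of $\{(1,1,1,1,1,3)\}\cup\{(v,2):v\in V\}$. - For $\mathcal X\subseteq\mathbb N^5$, let $\mathfrak P_{\mathcal X}$ be the set of all $\alpha\in[0,1]^5$ with $\sum_{i=1}^5\alpha_i=3$ and $\alpha\cdot v=2$ for every $v\in\mathcal X$. - A *rotation/mirror* is an element of the subgroup of $S_5$ generated by the permutations $(1\,2\,3\,4\,5)$ and $(3)(2\,4)(1\,5)$. A permutation $p\in S_5$ acts on vectors by $p(v)=(v_{p(1)},\dots,v_{p(5)})$ and on sets of vectors by $p(V)=\{p(v):v\in V\}$.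 - $\mathcal B_1,\dots,\mathcal B_{371}\subset\mathbb N^5$ are the 371 sets listed below. If $\mathcal X\subseteq\mathbb N^5$ is a non-empty good set such that $\mathfrak P_{\mathcal X}\cap\,]0,1[^5\neq\emptyset$, then there are an integer $i\in\{1,\dots,371\}$ and a rotation/mirror $r$ such that $$\mathfrak P_{\mathcal X}=\mathfrak P_{r(\operatorname{Compat}(\mathcal B_i))}.$$ The sets $\mathcal B_i$ follow, each as its index $i$ and then its elements; a vector is written as the string of its five coordinates, so that 01020 is $(0,1,0,2,0)$. 1: 11100; 2: 11010; 3: 00003 11100; 4: 00003 11010; 5: 11100 00004; 6: 11010 00004; 7: 00012 00111; 8: 00012 11010; 9: 00012 01011; 10: 00012 01110; 11: 00012 01200; 12: 00012 21000; 13: 00012 10110; 14: 00012 02100; 15: 00012 20100; 16: 00012 10011; 17: 00012 10200; 18: 00102 11100; 19: 11010 11100; 20: 11001 11100; 21: 01002 11100; 22: 10110 11100; 23: 00102 01020; 24: 00102 10110; 25: 00102 02010; 26: 00102 10101; 27: 00102 10020; 28: 01011 11010; 29: 00003 00012 00102; 30: 00003 00012 11001; 31: 00003 00012 01002; 32: 00003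 00012 01200; 33: 00003 00012 10101; 34: 00003 00012 02100; 35: 00003 00012 20100; 36: 00003 00102 11001; 37: 00003 11010 11100; 38: 00003 01002 10101; 39: 00003 10110 11100; 40: 00003 01110 11100; 41: 00003 01200 11100; 42: 00003 02100 11100; 43: 00003 10200 11100; 44: 00003 00102 01020; 45: 00003 00102 21000; 46: 00003 00102 02010; 47: 00003 02010 20100; 48: 00003 02100 20010; 49: 00003 00120 21000; 50: 00003 00120 10110; 51: 00003 00120 12000; 52: 00003 10110 11010; 53: 00003 02010 11010; 54: 00003 10020 11010; 55: 00003 00210 12000; 56: 00003 01200 20010; 57: 00003 01020 20100; 58: 00003 02010 10200; 59: 11001 11010 11100; 60: 10101 10110 11100; 61: 01200 11100 00004; 62: 02100 11100 00004; 63: 01020 11010 00004; 64: 02010 11010 00004; 65: 00111 01020 10200; 66: 00111 01200 10020; 67: 00120 01011 12000; 68: 00120 10011 21000; 69: 00210 01101 12000; 70: 01011 02100 10020; 71: 01020 10011 20100; 72: 01101 02010 10200; 73: 00012 00102 01011; 74: 00012 00102 01020; 75: 00012 00102 21000; 76: 00012 00102 10020; 77: 00012 00102 10011; 78: 00012 00102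 12000; 79: 00012 00111 01002; 80: 00012 00111 01011; 81: 00012 00111 02001; 82: 00012 00120 21000; 83: 00012 00120 10002; 84: 00012 00120 12000; 85: 00012 01101 21000; 86: 00012 02001 20100; 87: 00012 10101 12000; 88: 00012 01002 20100; 89: 00012 02100 10002; 90: 00012 00201 01011; 91: 00012 00201 21000; 92: 00012 00201 10011; 93: 00012 00201 12000; 94: 00012 01011 10011; 95: 00012 10110 11010; 96: 00012 01110 11010; 97: 00012 02100 11010; 98: 00012 11010 20100; 99: 00012 01002 10011; 100: 00012 10200 11001; 101: 00012 01200 11001; 102: 00012 12000 20100; 103: 00012 01002 10200; 104: 00012 01020 20100; 105: 00012 01020 10200; 106: 00012 01101 20100; 107: 00012 01110 10110; 108: 00012 01110 10200; 109: 00012 02001 10200; 110: 00012 02100 10020; 111: 00111 01110 20100; 112: 00201 02010 10200; 113: 10011 10200 11010; 114: 00102 02010 11100; 115: 00102 11100 20010; 116: 01020 01101 11100; 117: 00201 01020 11100; 118: 00201 02010 20100; 119: 02001 10200 11010; 120: 00102 02001 10020; 121: 00003 00012 00102 01002; 122: 00003 00012 00102 04000; 123: 00003 00012 02100 11001; 124: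 00003 00012 11001 20100; 125: 00003 00012 20100 21000; 126: 00003 00012 02100 12000; 127: 00003 00012 02100 21000; 128: 00003 00012 12000 20100; 129: 00003 00012 01002 00400; 130: 00003 00012 10101 21000; 131: 00003 00012 02100 00400; 132: 00003 00012 20100 00400; 133: 00003 00012 21000 03100; 134: 00003 00012 12000 30100; 135: 00003 00012 01200 20100; 136: 00003 00012 01200 04000; 137: 00003 00012 20100 01300; 138: 00003 00102 02010 11001; 139: 00003 02010 02100 11010; 140: 00003 00210 01002 10101; 141: 00003 00210 01200 10110; 142: 00003 00210 01110 10200; 143: 00003 01002 10101 20010; 144: 00003 00102 20010 21000; 145: 00003 00111 01200 20010; 146: 00003 00111 02010 10200; 147: 00003 01011 02100 20010; 148: 00003 02010 10011 20100; 149: 00003 01002 20010 20100; 150: 00003 00210 01011 12000; 151: 00003 00210 10011 21000; 152: 00003 00210 02100 00031; 153: 00003 00210 20100 00031; 154: 00003 02100 21000 00031; 155: 00003 12000 20100 00031; 156: 00003 12000 20010 00031; 157: 00003 02010 21000 00031; 158: 00003 10200 20010 00031; 159: 00003 01200 02010 00031; 160: 00003 01200 20100 00031; 161: 00003 01200 12000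 00031; 162: 00003 02100 10200 00031; 163: 00003 10200 21000 00031; 164: 00003 00102 02010 21000; 165: 00003 01101 02010 20100; 166: 00003 02100 10101 20010; 167: 00003 00210 01002 20100; 168: 00003 00210 01101 21000; 169: 00003 01002 10200 20010; 170: 00003 01200 11001 20010; 171: 00003 00102 02010 00040; 172: 00003 02010 20100 00040; 173: 00003 02100 20010 00040; 174: 00003 00210 01002 00040; 175: 00003 00210 21000 00040; 176: 00003 00210 02100 00040; 177: 00003 00210 12000 00040; 178: 00003 00210 20100 00040; 179: 00003 01002 20010 00040; 180: 00003 12000 20100 00040; 181: 00003 02100 21000 00040; 182: 00003 01200 20010 00040; 183: 00003 01200 02010 00040; 184: 00003 01200 20100 00040; 185: 00003 12000 20010 00040; 186: 00003 02010 10200 00040; 187: 00003 02010 21000 00040; 188: 00003 10200 21000 00040; 189: 00003 10200 20010 00040; 190: 00003 02010 20100 00400; 191: 00003 02100 20010 00400; 192: 00003 00210 21000 04000; 193: 00003 01200 20010 04000; 194: 00003 00102 21000 03010; 195: 00003 02010 20100 01030; 196: 00003 02100 20010 10030; 197: 00003 01002 20100 00310; 198: 00003 01101 02010 21000; 199: 00003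 10101 12000 20010; 200: 00003 00210 21000 00130; 201: 00003 00210 01101 20100; 202: 00003 00210 02100 10101; 203: 00003 00210 12000 00130; 204: 00003 10200 11001 20010; 205: 00003 01200 02010 11001; 206: 00003 01002 10200 30010; 207: 00003 01200 20010 10030; 208: 00003 02010 10200 01030; 209: 00003 02100 20010 01021; 210: 00003 02010 20100 10021; 211: 00003 01200 20010 00121; 212: 00003 00210 21000 10021; 213: 00003 01200 02010 20100; 214: 00003 02100 10200 20010; 215: 00003 00210 02100 21000; 216: 00003 00210 12000 20100; 217: 00003 01200 12000 20010; 218: 00003 02010 10200 21000; 219: 00003 02010 20100 01300; 220: 00003 02100 20010 10300; 221: 00003 00210 21000 03100; 222: 00003 00210 12000 30100; 223: 00003 01200 20010 13000; 224: 00003 02010 10200 31000; 225: 00003 00111 01020 20100; 226: 00003 00111 01020 20010; 227: 00003 00111 01200 20100; 228: 00003 01020 02100 20010; 229: 00003 02010 10020 20100; 230: 00003 02100 20010 01030; 231: 00003 02010 20100 10030; 232: 00003 00120 01020 10110; 233: 00003 00120 01011 21000; 234: 00003 00120 20010 00301; 235: 00003 00120 01011 20010; 236: 00003 00120 21000 00310;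 237: 00003 00120 02010 10011; 238: 00003 00120 02010 21000; 239: 00003 00120 12000 20010; 240: 00003 00120 21000 00400; 241: 00003 00120 02010 00400; 242: 00003 00120 20010 00400; 243: 00003 00120 21000 03010; 244: 00003 00120 12000 30010; 245: 00003 00120 01200 20010; 246: 00003 00120 01200 10101; 247: 00003 00120 01200 04000; 248: 00003 00120 20010 01300; 249: 00003 00120 10200 03001; 250: 00003 10011 12000 20100; 251: 00003 12000 20010 00130; 252: 00003 01200 20010 00130; 253: 00003 00210 01020 20100; 254: 00003 00210 01020 04000; 255: 00003 00210 20100 01030; 256: 00003 01020 20100 00211; 257: 00003 01020 20010 00301; 258: 00003 10020 20100 00301; 259: 00003 02010 10020 00301; 260: 00003 01020 20100 00310; 261: 00003 01020 20100 04000; 262: 00003 01020 02100 00400; 263: 00003 10020 20100 00400; 264: 02001 02010 02100 11001; 265: 00201 00210 01200 10101; 266: 00021 02010 11001 20100; 267: 00021 02100 11001 20010; 268: 00021 00210 10101 21000; 269: 00021 00210 01101 12000; 270: 00021 00210 02100 00004; 271: 00021 00210 20100 00004; 272: 00021 02100 21000 00004; 273: 00021 12000 20100 00004; 274: 00021 01200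 10101 20010; 275: 00021 01101 02010 10200; 276: 00021 01200 02010 00004; 277: 00021 01200 20100 00004; 278: 00021 01200 12000 00004; 279: 00021 02010 21000 00004; 280: 00021 10200 21000 00004; 281: 00021 12000 20010 00004; 282: 00021 02100 10200 00004; 283: 00021 10200 20010 00004; 284: 00201 02010 11001 20100; 285: 00201 02100 11001 20010; 286: 00210 02001 10101 21000; 287: 01200 02001 10101 20010; 288: 00210 02001 20100 00004; 289: 00201 02010 21000 00004; 290: 00201 12000 20010 00004; 291: 02001 10200 20010 00004; 292: 02100 10200 11001 20010; 293: 01200 02010 11001 20100; 294: 01200 10101 12000 20010; 295: 01101 02010 10200 21000; 296: 00210 02100 10101 21000; 297: 00210 01101 12000 20100; 298: 00111 01020 10200 20010; 299: 00111 01200 10020 20100; 300: 00120 00201 10011 21000; 301: 00120 00201 02010 00004; 302: 00120 00201 20010 00004; 303: 00120 02001 20010 00004; 304: 00120 01011 12000 20010; 305: 00120 02010 10011 21000; 306: 00120 01200 10101 20010; 307: 00120 01200 02001 00004; 308: 01020 02001 10011 20100; 309: 02001 10020 20100 00004; 310: 01200 02001 20100 00004; 311: 00201 12000 20100 00004; 312: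 00201 10020 20100 00004; 313: 00210 01020 10011 20100; 314: 00021 00111 01020 20010; 315: 00021 00111 02010 10020; 316: 00021 00120 01011 20010; 317: 00021 00210 01011 10020; 318: 00021 00210 01110 20100; 319: 00021 00210 02100 10110; 320: 00021 01200 02010 10200; 321: 00120 00201 01110 20010; 322: 00120 00201 02010 10110; 323: 01020 01110 02001 20010; 324: 00021 01200 02010 20100; 325: 00021 02100 10200 20010; 326: 00021 00210 02100 21000; 327: 00021 00210 12000 20100; 328: 00021 01200 12000 20010; 329: 00021 02010 10200 21000; 330: 00201 01020 02100 20010; 331: 00201 02010 10020 20100; 332: 00120 01200 02001 20010; 333: 00210 02001 10020 21000; 334: 00120 00201 02010 21000; 335: 00210 01020 02001 20100; 336: 00012 00120 21000 00301; 337: 00012 00120 12000 00301; 338: 00012 00120 21000 03001; 339: 00012 00120 12000 30001; 340: 00012 00120 01200 13000; 341: 00012 00120 02001 10300; 342: 00012 00120 10200 03100; 343: 00012 02001 20100 01030; 344: 00012 02001 20100 01300; 345: 00012 00201 21000 00130; 346: 00012 00201 12000 00130; 347: 00012 02001 21000 00130; 348: 00012 10200 21000 00130; 349: 00012 00201 12000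 30100; 350: 00012 02100 10200 01120; 351: 00012 12000 20100 01300; 352: 00012 00201 01020 13000; 353: 00012 00201 20100 01030; 354: 00012 00201 02100 10030; 355: 00012 00201 10020 03010; 356: 00012 01020 20100 00211; 357: 00012 01020 20100 00301; 358: 00012 02100 10020 00301; 359: 00012 02001 10020 00310; 360: 00012 12000 20100 01030; 361: 00012 01020 12000 01300; 362: 00012 01020 10200 03001; 363: 00012 01020 10200 30001; 364: 00012 02001 10200 01030; 365: 00012 02001 10200 31000; 366: 00012 10020 20100 01300; 367: 01020 02001 20100 00013; 368: 02001 10020 20100 00013; 369: 01020 02001 10200 00013; 370: 01020 10200 20010 00013; 371: 01020 02001 10200 30010. -/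

import Mathlib

namespace Pentagon

/-- `𝒳 ⊆ ℕ⁵` is good: every `u ∈ ℝ⁵` with coordinate sum `0` is either orthogonal to all of `𝒳`,
or takes both a negative and a positive value on `𝒳`. -/
def IsGood (X : Set (Fin 5 → ℕ)) : Prop :=
  ∀ u : Fin 5 → ℝ, ∑ i, u i = 0 →
    (∀ v ∈ X, ∑ i, u i * (v i : ℝ) = 0) ∨
      ∃ v ∈ X, ∃ v' ∈ X, ∑ i, u i * (v i : ℝ) < 0 ∧ 0 < ∑ i, u i * (v' i : ℝ)

/-- The vector `(v, 2) ∈ ℝ⁵ × ℝ`. -/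
def lift (v : Fin 5 → ℕ) : (Fin 5 → ℝ) × ℝ := (fun i => (v i : ℝ), 2)

/-- The vectors `w ∈ ℕ⁵` such that `(w, 2)` is a linear combination of `(1, 1, 1, 1, 1, 3)` and the
`(v, 2)` with `v ∈ V`. -/
def Compat (V : Set (Fin 5 → ℕ)) : Set (Fin 5 → ℕ) :=
  {w | lift w ∈ Submodule.span ℝ (insert ((fun _ => 1, 3) : (Fin 5 → ℝ) × ℝ) (lift '' V))}

/-- The polytope of angle vectors (in units of `π`) for which the angles selected by each `v ∈ 𝒳`
sum to `2`. -/
def anglePolytope (X : Set (Fin 5 → ℕ)) : Set (Fin 5 → ℝ) :=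
  {α | (∀ i, 0 ≤ α i ∧ α i ≤ 1) ∧ ∑ i, α i = 3 ∧ ∀ v ∈ X, ∑ i, α i * (v i : ℝ) = 2}

/-- The rotation/mirror group, generated by `(1 2 3 4 5)` and `(3)(2 4)(1 5)`; the position
`k ∈ {1, …, 5}` is `k - 1 : Fin 5`. -/
def rotationMirror : Subgroup (Equiv.Perm (Fin 5)) :=
  Subgroup.closure {finRotate 5, Equiv.swap 1 3 * Equiv.swap 0 4}

/-- `p(v) = (v_{p(1)}, …, v_{p(5)})`. -/
def permVec (p : Equiv.Perm (Fin 5)) (v : Fin 5 → ℕ) : Fin 5 → ℕ := fun i => v (p i)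

/-- The vector of the five decimal digits of `n`, most significant digit first (the numeral `01020`
stands for the vector `(0, 1, 0, 2, 0)`). -/
def digitVec (n : ℕ) : Fin 5 → ℕ := fun i => n / 10 ^ (4 - (i : ℕ)) % 10

set_option maxRecDepth 10000 in
/-- The `371` sets `ℬ₁, …, ℬ₃₇₁`, in this order. -/
def table : List (List ℕ) := [
   [11100], [11010], [00003, 11100], [00003, 11010], [11100, 00004], [11010, 00004],
   [00012, 00111], [00012, 11010], [00012, 01011], [00012, 01110], [00012, 01200], [00012, 21000],
   [00012, 10110], [00012, 02100], [00012, 20100], [00012, 10011], [00012, 10200], [00102, 11100],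
   [11010, 11100], [11001, 11100], [01002, 11100], [10110, 11100], [00102, 01020], [00102, 10110],
   [00102, 02010], [00102, 10101], [00102, 10020], [01011, 11010], [00003, 00012, 00102],
   [00003, 00012, 11001], [00003, 00012, 01002], [00003, 00012, 01200], [00003, 00012, 10101],
   [00003, 00012, 02100], [00003, 00012, 20100], [00003, 00102, 11001], [00003, 11010, 11100],
   [00003, 01002, 10101], [00003, 10110, 11100], [00003, 01110, 11100], [00003, 01200, 11100],
   [00003, 02100, 11100], [00003, 10200, 11100], [00003, 00102, 01020], [00003, 00102, 21000],
   [00003, 00102, 02010], [00003, 02010, 20100], [00003, 02100, 20010], [00003, 00120, 21000],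
   [00003, 00120, 10110], [00003, 00120, 12000], [00003, 10110, 11010], [00003, 02010, 11010],
   [00003, 10020, 11010], [00003, 00210, 12000], [00003, 01200, 20010], [00003, 01020, 20100],
   [00003, 02010, 10200], [11001, 11010, 11100], [10101, 10110, 11100], [01200, 11100, 00004],
   [02100, 11100, 00004], [01020, 11010, 00004], [02010, 11010, 00004], [00111, 01020, 10200],
   [00111, 01200, 10020], [00120, 01011, 12000], [00120, 10011, 21000], [00210, 01101, 12000],
   [01011, 02100, 10020], [01020, 10011, 20100], [01101, 02010, 10200], [00012, 00102, 01011],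
   [00012, 00102, 01020], [00012, 00102, 21000], [00012, 00102, 10020], [00012, 00102, 10011],
   [00012, 00102, 12000], [00012, 00111, 01002], [00012, 00111, 01011], [00012, 00111, 02001],
   [00012, 00120, 21000], [00012, 00120, 10002], [00012, 00120, 12000], [00012, 01101, 21000],
   [00012, 02001, 20100], [00012, 10101, 12000], [00012, 01002, 20100], [00012, 02100, 10002],
   [00012, 00201, 01011], [00012, 00201, 21000], [00012, 00201, 10011], [00012, 00201, 12000],
   [00012, 01011, 10011], [00012, 10110, 11010], [00012, 01110, 11010], [00012, 02100, 11010],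
   [00012, 11010, 20100], [00012, 01002, 10011], [00012, 10200, 11001], [00012, 01200, 11001],
   [00012, 12000, 20100], [00012, 01002, 10200], [00012, 01020, 20100], [00012, 01020, 10200],
   [00012, 01101, 20100], [00012, 01110, 10110], [00012, 01110, 10200], [00012, 02001, 10200],
   [00012, 02100, 10020], [00111, 01110, 20100], [00201, 02010, 10200], [10011, 10200, 11010],
   [00102, 02010, 11100], [00102, 11100, 20010], [01020, 01101, 11100], [00201, 01020, 11100],
   [00201, 02010, 20100], [02001, 10200, 11010], [00102, 02001, 10020],
   [00003, 00012, 00102, 01002], [00003, 00012, 00102, 04000], [00003, 00012, 02100, 11001],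
   [00003, 00012, 11001, 20100], [00003, 00012, 20100, 21000], [00003, 00012, 02100, 12000],
   [00003, 00012, 02100, 21000], [00003, 00012, 12000, 20100], [00003, 00012, 01002, 00400],
   [00003, 00012, 10101, 21000], [00003, 00012, 02100, 00400], [00003, 00012, 20100, 00400],
   [00003, 00012, 21000, 03100], [00003, 00012, 12000, 30100], [00003, 00012, 01200, 20100],
   [00003, 00012, 01200, 04000], [00003, 00012, 20100, 01300], [00003, 00102, 02010, 11001],
   [00003, 02010, 02100, 11010], [00003, 00210, 01002, 10101], [00003, 00210, 01200, 10110],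
   [00003, 00210, 01110, 10200], [00003, 01002, 10101, 20010], [00003, 00102, 20010, 21000],
   [00003, 00111, 01200, 20010], [00003, 00111, 02010, 10200], [00003, 01011, 02100, 20010],
   [00003, 02010, 10011, 20100], [00003, 01002, 20010, 20100], [00003, 00210, 01011, 12000],
   [00003, 00210, 10011, 21000], [00003, 00210, 02100, 00031], [00003, 00210, 20100, 00031],
   [00003, 02100, 21000, 00031], [00003, 12000, 20100, 00031], [00003, 12000, 20010, 00031],
   [00003, 02010, 21000, 00031], [00003, 10200, 20010, 00031], [00003, 01200, 02010, 00031],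
   [00003, 01200, 20100, 00031], [00003, 01200, 12000, 00031], [00003, 02100, 10200, 00031],
   [00003, 10200, 21000, 00031], [00003, 00102, 02010, 21000], [00003, 01101, 02010, 20100],
   [00003, 02100, 10101, 20010], [00003, 00210, 01002, 20100], [00003, 00210, 01101, 21000],
   [00003, 01002, 10200, 20010], [00003, 01200, 11001, 20010], [00003, 00102, 02010, 00040],
   [00003, 02010, 20100, 00040], [00003, 02100, 20010, 00040], [00003, 00210, 01002, 00040],
   [00003, 00210, 21000, 00040], [00003, 00210, 02100, 00040], [00003, 00210, 12000, 00040],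
   [00003, 00210, 20100, 00040], [00003, 01002, 20010, 00040], [00003, 12000, 20100, 00040],
   [00003, 02100, 21000, 00040], [00003, 01200, 20010, 00040], [00003, 01200, 02010, 00040],
   [00003, 01200, 20100, 00040], [00003, 12000, 20010, 00040], [00003, 02010, 10200, 00040],
   [00003, 02010, 21000, 00040], [00003, 10200, 21000, 00040], [00003, 10200, 20010, 00040],
   [00003, 02010, 20100, 00400], [00003, 02100, 20010, 00400], [00003, 00210, 21000, 04000],
   [00003, 01200, 20010, 04000], [00003, 00102, 21000, 03010], [00003, 02010, 20100, 01030],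
   [00003, 02100, 20010, 10030], [00003, 01002, 20100, 00310], [00003, 01101, 02010, 21000],
   [00003, 10101, 12000, 20010], [00003, 00210, 21000, 00130], [00003, 00210, 01101, 20100],
   [00003, 00210, 02100, 10101], [00003, 00210, 12000, 00130], [00003, 10200, 11001, 20010],
   [00003, 01200, 02010, 11001], [00003, 01002, 10200, 30010], [00003, 01200, 20010, 10030],
   [00003, 02010, 10200, 01030], [00003, 02100, 20010, 01021], [00003, 02010, 20100, 10021],
   [00003, 01200, 20010, 00121], [00003, 00210, 21000, 10021], [00003, 01200, 02010, 20100],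
   [00003, 02100, 10200, 20010], [00003, 00210, 02100, 21000], [00003, 00210, 12000, 20100],
   [00003, 01200, 12000, 20010], [00003, 02010, 10200, 21000], [00003, 02010, 20100, 01300],
   [00003, 02100, 20010, 10300], [00003, 00210, 21000, 03100], [00003, 00210, 12000, 30100],
   [00003, 01200, 20010, 13000], [00003, 02010, 10200, 31000], [00003, 00111, 01020, 20100],
   [00003, 00111, 01020, 20010], [00003, 00111, 01200, 20100], [00003, 01020, 02100, 20010],
   [00003, 02010, 10020, 20100], [00003, 02100, 20010, 01030], [00003, 02010, 20100, 10030],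
   [00003, 00120, 01020, 10110], [00003, 00120, 01011, 21000], [00003, 00120, 20010, 00301],
   [00003, 00120, 01011, 20010], [00003, 00120, 21000, 00310], [00003, 00120, 02010, 10011],
   [00003, 00120, 02010, 21000], [00003, 00120, 12000, 20010], [00003, 00120, 21000, 00400],
   [00003, 00120, 02010, 00400], [00003, 00120, 20010, 00400], [00003, 00120, 21000, 03010],
   [00003, 00120, 12000, 30010], [00003, 00120, 01200, 20010], [00003, 00120, 01200, 10101],
   [00003, 00120, 01200, 04000], [00003, 00120, 20010, 01300], [00003, 00120, 10200, 03001],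
   [00003, 10011, 12000, 20100], [00003, 12000, 20010, 00130], [00003, 01200, 20010, 00130],
   [00003, 00210, 01020, 20100], [00003, 00210, 01020, 04000], [00003, 00210, 20100, 01030],
   [00003, 01020, 20100, 00211], [00003, 01020, 20010, 00301], [00003, 10020, 20100, 00301],
   [00003, 02010, 10020, 00301], [00003, 01020, 20100, 00310], [00003, 01020, 20100, 04000],
   [00003, 01020, 02100, 00400], [00003, 10020, 20100, 00400], [02001, 02010, 02100, 11001],
   [00201, 00210, 01200, 10101], [00021, 02010, 11001, 20100], [00021, 02100, 11001, 20010],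
   [00021, 00210, 10101, 21000], [00021, 00210, 01101, 12000], [00021, 00210, 02100, 00004],
   [00021, 00210, 20100, 00004], [00021, 02100, 21000, 00004], [00021, 12000, 20100, 00004],
   [00021, 01200, 10101, 20010], [00021, 01101, 02010, 10200], [00021, 01200, 02010, 00004],
   [00021, 01200, 20100, 00004], [00021, 01200, 12000, 00004], [00021, 02010, 21000, 00004],
   [00021, 10200, 21000, 00004], [00021, 12000, 20010, 00004], [00021, 02100, 10200, 00004],
   [00021, 10200, 20010, 00004], [00201, 02010, 11001, 20100], [00201, 02100, 11001, 20010],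
   [00210, 02001, 10101, 21000], [01200, 02001, 10101, 20010], [00210, 02001, 20100, 00004],
   [00201, 02010, 21000, 00004], [00201, 12000, 20010, 00004], [02001, 10200, 20010, 00004],
   [02100, 10200, 11001, 20010], [01200, 02010, 11001, 20100], [01200, 10101, 12000, 20010],
   [01101, 02010, 10200, 21000], [00210, 02100, 10101, 21000], [00210, 01101, 12000, 20100],
   [00111, 01020, 10200, 20010], [00111, 01200, 10020, 20100], [00120, 00201, 10011, 21000],
   [00120, 00201, 02010, 00004], [00120, 00201, 20010, 00004], [00120, 02001, 20010, 00004],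
   [00120, 01011, 12000, 20010], [00120, 02010, 10011, 21000], [00120, 01200, 10101, 20010],
   [00120, 01200, 02001, 00004], [01020, 02001, 10011, 20100], [02001, 10020, 20100, 00004],
   [01200, 02001, 20100, 00004], [00201, 12000, 20100, 00004], [00201, 10020, 20100, 00004],
   [00210, 01020, 10011, 20100], [00021, 00111, 01020, 20010], [00021, 00111, 02010, 10020],
   [00021, 00120, 01011, 20010], [00021, 00210, 01011, 10020], [00021, 00210, 01110, 20100],
   [00021, 00210, 02100, 10110], [00021, 01200, 02010, 10200], [00120, 00201, 01110, 20010],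
   [00120, 00201, 02010, 10110], [01020, 01110, 02001, 20010], [00021, 01200, 02010, 20100],
   [00021, 02100, 10200, 20010], [00021, 00210, 02100, 21000], [00021, 00210, 12000, 20100],
   [00021, 01200, 12000, 20010], [00021, 02010, 10200, 21000], [00201, 01020, 02100, 20010],
   [00201, 02010, 10020, 20100], [00120, 01200, 02001, 20010], [00210, 02001, 10020, 21000],
   [00120, 00201, 02010, 21000], [00210, 01020, 02001, 20100], [00012, 00120, 21000, 00301],
   [00012, 00120, 12000, 00301], [00012, 00120, 21000, 03001], [00012, 00120, 12000, 30001],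
   [00012, 00120, 01200, 13000], [00012, 00120, 02001, 10300], [00012, 00120, 10200, 03100],
   [00012, 02001, 20100, 01030], [00012, 02001, 20100, 01300], [00012, 00201, 21000, 00130],
   [00012, 00201, 12000, 00130], [00012, 02001, 21000, 00130], [00012, 10200, 21000, 00130],
   [00012, 00201, 12000, 30100], [00012, 02100, 10200, 01120], [00012, 12000, 20100, 01300],
   [00012, 00201, 01020, 13000], [00012, 00201, 20100, 01030], [00012, 00201, 02100, 10030],
   [00012, 00201, 10020, 03010], [00012, 01020, 20100, 00211], [00012, 01020, 20100, 00301],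
   [00012, 02100, 10020, 00301], [00012, 02001, 10020, 00310], [00012, 12000, 20100, 01030],
   [00012, 01020, 12000, 01300], [00012, 01020, 10200, 03001], [00012, 01020, 10200, 30001],
   [00012, 02001, 10200, 01030], [00012, 02001, 10200, 31000], [00012, 10020, 20100, 01300],
   [01020, 02001, 20100, 00013], [02001, 10020, 20100, 00013], [01020, 02001, 10200, 00013],
   [01020, 10200, 20010, 00013], [01020, 02001, 10200, 30010]]

/-- The set `ℬᵢ`, for `1 ≤ i ≤ 371`. -/
def B (i : ℕ) : Set (Fin 5 → ℕ) := {v | ∃ n ∈ table.getD (i - 1) [], v = digitVec n}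

end Pentagon

namespace Pentagon

/-! Call 3w − 2(1,…,1) the excess of w. For α with coordinate sum 3, α·w = 2 says that α is
orthogonal to the excess of w. Hence the polytope of a set depends only on the orthogonal complement
of its excess vectors, and passing to `Compat` does not change it (`anglePolytope_image_Compat`). It
suffices to find a rotated or mirrored ℬᵢ with the same complement as 𝒳.

Fix an interior α in the polytope of 𝒳. Subtracting a multiple of α gives any y coordinate sum 0 and
does not change its products with the excess vectors of 𝒳. So goodness says: for every y, either all
excess vectors of 𝒳 are orthogonal to y, or one of them has a negative product with y
(`exists_dotProduct_neg`). Permuting coordinates makes α increasing. This permutation is arbitrary,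
so 𝒳 is first classified up to all of S₅.

The classification is a finite search. Suppose that the excess vectors of a list V lie in the span
of those of 𝒳. Then α lies in an explicit polyhedral cone with finitely many generators. Choose a
test vector y. If an excess vector x from 𝒳 has x·y < 0, then x·α = 0 forces x·p ≤ 0 for some
generator p, so x·(y + tp) < 0 for all t ≥ 0. When some y + tp is positive in all coordinates, only
finitely many w in ℕ⁵ are possible. Each of them is excluded, or leads to a larger span that
contains the list of a later node (`searchAll_spec`, `testOk_spec`). If instead 𝒳 is orthogonal to
all tests of the node, either this is contradictory, or the tests confine 𝒳 so much that its
complement is that of V, which is the complement of a permuted ℬₖ for one of 51 representatives k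
(`endOk_spec`). The kernel checks a certificate of 354 nodes, and `settled_of_nodesOk` turns the
check into the classification.

To return from S₅ to the dihedral group, every permutation is written as one of 12 coset
representatives composed with a rotation or mirror. A second table exhibits the image of each ℬₖ
under each coset representative as equivalent to a rotated or mirrored ℬᵢ
(`exists_rotationMirror_isPerp_iff`). -/

/-- An integer vector with five coordinates. -/
structure IntVec where
  a : ℤ
  b : ℤ
  c : ℤ
  d : ℤ
  e : ℤ

/-! ### Integer vectors and their real images -/

namespace IntVec

def toReal (x : IntVec) : Fin 5 → ℝ := ![x.a, x.b, x.c, x.d, x.e]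

/-! The operations are written with `Int.add` and `Int.mul` because that is what the kernel
evaluates fastest. -/

def dot : IntVec → IntVec → ℤ
  | ⟨a, b, c, d, e⟩, ⟨a', b', c', d', e'⟩ =>
    Int.add (Int.mul a a') (Int.add (Int.mul b b') (Int.add (Int.mul c c')
      (Int.add (Int.mul d d') (Int.mul e e'))))

def sum : IntVec → ℤ
  | ⟨a, b, c, d, e⟩ => Int.add a (Int.add b (Int.add c (Int.add d e)))

def add : IntVec → IntVec → IntVec
  | ⟨a, b, c, d, e⟩, ⟨a', b', c', d', e'⟩ =>
    ⟨Int.add a a', Int.add b b', Int.add c c', Int.add d d', Int.add e e'⟩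

/-- The combination `s x + t y`. -/
def comb (s : ℤ) (x : IntVec) (t : ℤ) (y : IntVec) : IntVec :=
  match x, y with
  | ⟨a, b, c, d, e⟩, ⟨a', b', c', d', e'⟩ =>
    ⟨Int.add (Int.mul s a) (Int.mul t a'), Int.add (Int.mul s b) (Int.mul t b'),
      Int.add (Int.mul s c) (Int.mul t c'), Int.add (Int.mul s d) (Int.mul t d'),
      Int.add (Int.mul s e) (Int.mul t e')⟩

theorem dot_eq (x y : IntVec) :
    x.dot y = x.a * y.a + (x.b * y.b + (x.c * y.c + (x.d * y.d + x.e * y.e))) := rfl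

theorem sum_eq (x : IntVec) : x.sum = x.a + (x.b + (x.c + (x.d + x.e))) := rfl

theorem add_eq (x y : IntVec) :
    x.add y = ⟨x.a + y.a, x.b + y.b, x.c + y.c, x.d + y.d, x.e + y.e⟩ := rfl

theorem comb_eq (s : ℤ) (x : IntVec) (t : ℤ) (y : IntVec) : comb s x t y = ⟨s * x.a + t * y.a,
    s * x.b + t * y.b, s * x.c + t * y.c, s * x.d + t * y.d, s * x.e + t * y.e⟩ := rfl

def get (x : IntVec) : Fin 5 → ℤ
  | 0 => x.a
  | 1 => x.b
  | 2 => x.c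
  | 3 => x.d
  | 4 => x.e

theorem toReal_apply (x : IntVec) (i : Fin 5) : x.toReal i = x.get i := by
  fin_cases i <;> rfl

theorem toReal_dotProduct_toReal (x y : IntVec) : x.toReal ⬝ᵥ y.toReal = x.dot y := by
  simp [dotProduct, Fin.sum_univ_five, toReal, dot_eq, add_assoc]

theorem sum_toReal (x : IntVec) : ∑ i, x.toReal i = x.sum := by
  simp [Fin.sum_univ_five, toReal, sum_eq, add_assoc]

theorem toReal_add (x y : IntVec) : (x.add y).toReal = x.toReal + y.toReal := by
  ext i; fin_cases i <;> simp [add_eq, toReal]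

theorem toReal_comb (s : ℤ) (x : IntVec) (t : ℤ) (y : IntVec) :
    (comb s x t y).toReal = (s : ℝ) • x.toReal + (t : ℝ) • y.toReal := by
  ext i; fin_cases i <;> simp [comb_eq, toReal]

end IntVec

/-! ### Forced evaluation

`forceList l f` is `f l`, but lets the kernel evaluate `l` before it substitutes it into `f`. -/

def forceNat {α : Sort*} : ℕ → (ℕ → α) → α
  | 0, f => f 0
  | n + 1, f => f (Nat.succ n)

def forceInt {α : Sort*} : ℤ → (ℤ → α) → α
  | .ofNat 0, f => f (.ofNat 0)
  | .ofNat (n + 1), f => f (.ofNat (Nat.succ n))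
  | .negSucc 0, f => f (.negSucc 0)
  | .negSucc (n + 1), f => f (.negSucc (Nat.succ n))

def IntVec.force {α : Sort*} : IntVec → (IntVec → α) → α
  | ⟨a, b, c, d, e⟩, f => forceInt a fun a => forceInt b fun b => forceInt c fun c =>
    forceInt d fun d => forceInt e fun e => f ⟨a, b, c, d, e⟩

def forceList {α : Sort*} : List IntVec → (List IntVec → α) → α
  | [], f => f []
  | x :: l, f => x.force fun x => forceList l fun l => f (x :: l)

def forceLists {α : Sort*} : List (List IntVec) → (List (List IntVec) → α) → α
  | [], f => f []
  | l :: L, f => forceList l fun l => forceLists L fun L => f (l :: L)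

theorem forceNat_eq {α : Sort*} (n : ℕ) (f : ℕ → α) : forceNat n f = f n := by
  cases n <;> rfl

theorem forceInt_eq {α : Sort*} (n : ℤ) (f : ℤ → α) : forceInt n f = f n := by
  rcases n with (_ | n) | (_ | n) <;> rfl

theorem IntVec.force_eq {α : Sort*} (x : IntVec) (f : IntVec → α) : x.force f = f x := by
  simp only [IntVec.force, forceInt_eq]

theorem forceList_eq {α : Sort*} (l : List IntVec) (f : List IntVec → α) :
    forceList l f = f l := by
  induction l generalizing f with
  | nil => rfl
  | cons x l ih => rw [forceList, IntVec.force_eq, ih]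

theorem forceLists_eq {α : Sort*} (L : List (List IntVec)) (f : List (List IntVec) → α) :
    forceLists L f = f L := by
  induction L generalizing f with
  | nil => rfl
  | cons l L ih => rw [forceLists, forceList_eq, ih]

/-! ### Sign tests -/

def isZero : ℤ → Bool
  | .ofNat 0 => true
  | _ => false

def isNeg : ℤ → Bool
  | .ofNat _ => false
  | .negSucc _ => true

def isPos : ℤ → Bool
  | .ofNat 0 => false
  | .ofNat (_ + 1) => true
  | .negSucc _ => false

theorem isZero_iff (n : ℤ) : isZero n = true ↔ n = 0 := by
  rcases n with (_ | n) | n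
  · exact ⟨fun _ => rfl, fun _ => rfl⟩
  · exact ⟨fun h => Bool.noConfusion h, fun h => by simp at h; omega⟩
  · exact ⟨fun h => Bool.noConfusion h, fun h => by simp at h⟩

theorem isNeg_iff (n : ℤ) : isNeg n = true ↔ n < 0 := by
  rcases n with n | n <;> simp [isNeg]

theorem isPos_iff (n : ℤ) : isPos n = true ↔ 0 < n := by
  rcases n with (_ | n) | n
  · exact ⟨fun h => Bool.noConfusion h, fun h => by simp at h⟩
  · exact ⟨fun _ => by simp, fun _ => rfl⟩
  · exact ⟨fun h => Bool.noConfusion h, fun h => by simp at h⟩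

/-! ### Linear spans -/

/-- Generators of the vectors in the span of `G` that are orthogonal to `h`. -/
def reduceBy (G : List IntVec) (h : IntVec) : List IntVec :=
  match G.filter fun g => !isZero (g.dot h) with
  | [] => G
  | g₀ :: G' => (G.filter fun g => isZero (g.dot h)) ++
      G'.map fun g => IntVec.comb (g₀.dot h) g (Int.neg (g.dot h)) g₀

def stdBasis : List IntVec :=
  [⟨1, 0, 0, 0, 0⟩, ⟨0, 1, 0, 0, 0⟩, ⟨0, 0, 1, 0, 0⟩, ⟨0, 0, 0, 1, 0⟩, ⟨0, 0, 0, 0, 1⟩]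

/-- Generators of the orthogonal complement of `V`. -/
def nullGens : List IntVec → List IntVec
  | [] => stdBasis
  | v :: V => forceList (nullGens V) fun G => reduceBy G v

def linSpan (G : List IntVec) : Submodule ℝ (Fin 5 → ℝ) :=
  Submodule.span ℝ (IntVec.toReal '' {g | g ∈ G})

/-- `β` is orthogonal to all elements of `V`. -/
def IsOrth (V : List IntVec) (β : Fin 5 → ℝ) : Prop := ∀ v ∈ V, v.toReal ⬝ᵥ β = 0

theorem toReal_mem_linSpan {G : List IntVec} {g : IntVec} (h : g ∈ G) : g.toReal ∈ linSpan G :=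
  Submodule.subset_span ⟨g, h, rfl⟩

/-- One step of Gaussian elimination with pivot g₀. The linear map γ ↦ (g₀·h)γ − (h·γ)g₀ sends every
generator into the new span, and on vectors orthogonal to h it is multiplication by the nonzero
scalar g₀·h. -/
theorem mem_linSpan_reduceBy {G : List IntVec} {h : IntVec} {β : Fin 5 → ℝ} (hβ : β ∈ linSpan G)
    (hh : h.toReal ⬝ᵥ β = 0) : β ∈ linSpan (reduceBy G h) := by
  unfold reduceBy
  split
  · exact hβ
  · next g₀ G' hG =>
    have hs : ((g₀.dot h : ℤ) : ℝ) ≠ 0 := by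
      have := (List.mem_filter.1 (hG ▸ List.mem_cons_self)).2
      rw [Bool.not_eq_true', ← Bool.not_eq_true, isZero_iff] at this
      exact_mod_cast this
    set K := linSpan ((G.filter fun g => isZero (g.dot h)) ++
      G'.map fun g => IntVec.comb (g₀.dot h) g (Int.neg (g.dot h)) g₀)
    have key : ∀ γ ∈ linSpan G,
        ((g₀.dot h : ℤ) : ℝ) • γ - (h.toReal ⬝ᵥ γ) • g₀.toReal ∈ K := by
      intro γ hγ
      induction hγ using Submodule.span_induction with
      | mem x hx =>
        obtain ⟨g, hg, rfl⟩ := hx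
        rw [dotProduct_comm, IntVec.toReal_dotProduct_toReal]
        rcases eq_or_ne (g.dot h) 0 with h0 | h0
        · rw [h0, Int.cast_zero, zero_smul, sub_zero]
          exact K.smul_mem _ (toReal_mem_linSpan (List.mem_append_left _
            (List.mem_filter.2 ⟨hg, (isZero_iff _).2 h0⟩)))
        have hm : g ∈ g₀ :: G' := by
          rw [← hG, List.mem_filter, Bool.not_eq_true', ← Bool.not_eq_true, isZero_iff]
          exact ⟨hg, h0⟩
        rcases List.mem_cons.1 hm with rfl | hm
        · simp
        have := toReal_mem_linSpan (List.mem_append_right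
          (G.filter fun g => isZero (g.dot h)) (List.mem_map_of_mem (f := fun g =>
          IntVec.comb (g₀.dot h) g (Int.neg (g.dot h)) g₀) hm))
        rw [IntVec.toReal_comb] at this
        rw [sub_eq_add_neg, ← neg_smul]
        exact_mod_cast this
      | zero => simp
      | add x y _ _ hx hy =>
        convert K.add_mem hx hy using 1
        rw [dotProduct_add]; module
      | smul t x _ hx =>
        convert K.smul_mem t hx using 1
        rw [dotProduct_smul, smul_eq_mul]; module
    have := key β hβ
    rw [hh, zero_smul, sub_zero] at this
    exact (K.smul_mem_iff hs).1 this

theorem mem_linSpan_stdBasis (β : Fin 5 → ℝ) : β ∈ linSpan stdBasis := by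
  have : β = β 0 • (⟨1, 0, 0, 0, 0⟩ : IntVec).toReal + β 1 • (⟨0, 1, 0, 0, 0⟩ : IntVec).toReal
      + β 2 • (⟨0, 0, 1, 0, 0⟩ : IntVec).toReal + β 3 • (⟨0, 0, 0, 1, 0⟩ : IntVec).toReal
      + β 4 • (⟨0, 0, 0, 0, 1⟩ : IntVec).toReal := by
    ext i; fin_cases i <;> simp [IntVec.toReal]
  rw [this]
  refine add_mem (add_mem (add_mem (add_mem ?_ ?_) ?_) ?_) ?_ <;>
    exact Submodule.smul_mem _ _ (toReal_mem_linSpan (by simp [stdBasis]))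

/-- The generators found by elimination suffice for the whole complement. With
`isOrth_of_mem_linSpan` this makes an inclusion of orthogonal complements a finite integer check. -/
theorem IsOrth.mem_linSpan {V : List IntVec} {β : Fin 5 → ℝ} (hV : IsOrth V β) :
    β ∈ linSpan (nullGens V) := by
  induction V with
  | nil => exact mem_linSpan_stdBasis β
  | cons v V ih =>
    rw [nullGens, forceList_eq]
    exact mem_linSpan_reduceBy (ih fun u hu => hV u (List.mem_cons_of_mem _ hu))
      (hV v List.mem_cons_self)

/-- All elements of `G` are orthogonal to all elements of `V`. -/
def allOrth (G V : List IntVec) : Bool := V.all fun v => G.all fun g => isZero (g.dot v)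

theorem isOrth_of_mem_linSpan {G V : List IntVec} (h : allOrth G V = true) {β : Fin 5 → ℝ}
    (hβ : β ∈ linSpan G) : IsOrth V β := by
  intro v hv
  simp only [allOrth, List.all_eq_true, isZero_iff] at h
  induction hβ using Submodule.span_induction with
  | mem x hx =>
    obtain ⟨g, hg, rfl⟩ := hx
    rw [dotProduct_comm, IntVec.toReal_dotProduct_toReal, h v hv g hg, Int.cast_zero]
  | zero => simp
  | add x y _ _ hx hy => rw [dotProduct_add, hx, hy, add_zero]
  | smul t x _ hx => rw [dotProduct_smul, hx, smul_zero]

/-! ### Convex cones -/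

open scoped NNReal

def cone (Q : List IntVec) : Submodule ℝ≥0 (Fin 5 → ℝ) :=
  Submodule.span ℝ≥0 (IntVec.toReal '' {g | g ∈ Q})

theorem toReal_mem_cone {Q : List IntVec} {g : IntVec} (h : g ∈ Q) : g.toReal ∈ cone Q :=
  Submodule.subset_span ⟨g, h, rfl⟩

theorem smul_mem_of_nonneg {E : Type*} [AddCommGroup E] [Module ℝ E] (C : Submodule ℝ≥0 E) {t : ℝ}
    (ht : 0 ≤ t) {x : E} (hx : x ∈ C) : t • x ∈ C :=
  C.smul_mem ⟨t, ht⟩ hx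

/-- A cone cut by a half-space or hyperplane is generated by the generators inside and the
crossing points of the pairs of generators on different sides. -/
theorem sum_mem_of_crossings_mem {ι E : Type*} [Fintype ι] [AddCommGroup E] [Module ℝ E]
    (C : Submodule ℝ≥0 E) (v : ι → E) (c : ι → ℝ) (hc : ∀ i, 0 ≤ c i) (s : ι → ℝ)
    (hsum : 0 ≤ ∑ i, c i * s i) (hzero : ∀ i, s i = 0 → v i ∈ C)
    (hpos : 0 < ∑ i, c i * s i → ∀ i, 0 < s i → v i ∈ C)
    (hcross : ∀ i j, 0 < s i → s j < 0 → s i • v j + (-s j) • v i ∈ C) :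
    ∑ i, c i • v i ∈ C := by
  -- P and N are the total weights on the positive and on the negative side, so that P − N ≥ 0 is
  -- the value of the combination.
  set P := ∑ i, c i * max (s i) 0 with hP
  set N := ∑ i, c i * max (-s i) 0 with hN
  have hPN : P - N = ∑ i, c i * s i := by
    rw [hP, hN, ← Finset.sum_sub_distrib]
    refine Finset.sum_congr rfl fun i _ => ?_
    rw [← mul_sub]
    congr 1
    rcases le_total 0 (s i) with h | h
    · rw [max_eq_left h, max_eq_right (by linarith)]; ring
    · rw [max_eq_right h, max_eq_left (by linarith)]; ring
  have hP0 : ∀ i ∈ Finset.univ, 0 ≤ c i * max (s i) 0 := fun i _ =>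
    mul_nonneg (hc i) (le_max_right _ _)
  have hN0 : ∀ i ∈ Finset.univ, 0 ≤ c i * max (-s i) 0 := fun i _ =>
    mul_nonneg (hc i) (le_max_right _ _)
  rcases (Finset.sum_nonneg hP0).eq_or_lt with h0 | h0
  -- If P = 0, then N = 0 as well, so only generators with s = 0 carry weight.
  · have hPz := (Finset.sum_eq_zero_iff_of_nonneg hP0).1 h0.symm
    have hNz := (Finset.sum_eq_zero_iff_of_nonneg hN0).1 (by
      have := Finset.sum_nonneg hN0; linarith)
    refine C.sum_mem fun i hi => ?_
    rcases eq_or_ne (c i) 0 with h | h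
    · rw [h, zero_smul]; exact C.zero_mem
    · refine smul_mem_of_nonneg C (hc i) (hzero i ?_)
      have h1 := (mul_eq_zero.1 (hPz i hi)).resolve_left h
      have h2 := (mul_eq_zero.1 (hNz i hi)).resolve_left h
      have := le_max_left (s i) 0
      have := le_max_left (-s i) 0
      linarith
  -- Summing the crossing points with weights c i * c j gives P times the negative part plus N times
  -- the positive part. Adding (P − N) times the positive part and P times the part with s = 0 gives
  -- P times the whole combination, with nonnegative coefficients.
  · have key : ∑ i, c i • v i = P⁻¹ • (∑ i, ((if s i = 0 then P * c i else 0) • v i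
        + (if 0 < s i then c i * (P - N) else 0) • v i
        + ∑ j, (if 0 < s i ∧ s j < 0 then c i * c j else 0) • (s i • v j + (-s j) • v i))) := by
      rw [eq_inv_smul_iff₀ h0.ne']
      have e1 : ∀ i j, (if 0 < s i ∧ s j < 0 then c i * c j else 0) • (s i • v j + (-s j) • v i)
          = (c i * max (s i) 0) • (if s j < 0 then c j else 0) • v j
            + (c j * max (-s j) 0) • (if 0 < s i then c i else 0) • v i := by
        intro i j
        rcases lt_or_ge 0 (s i) with h1 | h1 <;> rcases lt_or_ge (s j) 0 with h2 | h2
        · rw [if_pos ⟨h1, h2⟩, if_pos h1, if_pos h2, max_eq_left h1.le,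
            max_eq_left (by linarith)]; module
        · rw [if_neg (by simp [h2.not_gt]), if_neg h2.not_gt, max_eq_right (a := -s j)
            (by linarith)]; simp
        · rw [if_neg (by simp [h1.not_gt]), if_neg h1.not_gt, max_eq_right h1]; simp
        · rw [if_neg (by simp [h1.not_gt]), if_neg h1.not_gt, max_eq_right h1]; simp
      simp_rw [e1, Finset.sum_add_distrib, ← Finset.sum_smul, ← Finset.smul_sum]
      rw [← Finset.sum_smul, ← hP]
      simp_rw [← hN]
      simp only [Finset.smul_sum, ← Finset.sum_add_distrib]
      refine Finset.sum_congr rfl fun i _ => ?_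
      rcases lt_trichotomy (s i) 0 with h | h | h
      · simp only [if_neg h.ne, if_neg h.not_gt, if_pos h]; module
      · simp only [h, lt_irrefl, if_true, if_false]; module
      · simp only [if_neg h.ne', if_neg h.not_gt, if_pos h]; module
    rw [key]
    refine smul_mem_of_nonneg C (inv_nonneg.2 h0.le) (C.sum_mem fun i _ =>
      C.add_mem (C.add_mem ?_ ?_) (C.sum_mem fun j _ => ?_))
    · split_ifs with h
      · exact smul_mem_of_nonneg C (mul_nonneg h0.le (hc i)) (hzero i h)
      · rw [zero_smul]; exact C.zero_mem
    · split_ifs with h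
      · rw [hPN]
        rcases hsum.eq_or_lt with h' | h'
        · rw [← h', mul_zero, zero_smul]; exact C.zero_mem
        · exact smul_mem_of_nonneg C (mul_nonneg (hc i) hsum) (hpos h' i h)
      · rw [zero_smul]; exact C.zero_mem
    · split_ifs with h
      · exact smul_mem_of_nonneg C (mul_nonneg (hc i) (hc j)) (hcross i j h.1 h.2)
      · rw [zero_smul]; exact C.zero_mem

/-- The crossing points with `h^⊥` of the pairs of elements of `Q` on different sides of it. -/
def crossings (Q : List IntVec) (h : IntVec) : List IntVec :=
  (Q.filter fun p => isPos (p.dot h)).flatMap fun p =>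
    (Q.filter fun n => isNeg (n.dot h)).map fun n => IntVec.comb (p.dot h) n (Int.neg (n.dot h)) p

/-- Generators of the part of the cone over `Q` that is orthogonal to `h`. -/
def cut (Q : List IntVec) (h : IntVec) : List IntVec :=
  (Q.filter fun p => isZero (p.dot h)) ++ crossings Q h

/-- Common source of `mem_cone_cut` and `mem_cone_halfCut`: for a hyperplane `hpos` is vacuous, for
a half-space it supplies the generators strictly inside. -/
theorem mem_span_of_crossings {Q : List IntVec} {h : IntVec} {α : Fin 5 → ℝ} (hα : α ∈ cone Q)
    (C : Submodule ℝ≥0 (Fin 5 → ℝ)) (hsum : 0 ≤ h.toReal ⬝ᵥ α)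
    (hcut : ∀ p ∈ cut Q h, p.toReal ∈ C)
    (hpos : 0 < h.toReal ⬝ᵥ α → ∀ p ∈ Q, 0 < p.dot h → p.toReal ∈ C) : α ∈ C := by
  have hr : IntVec.toReal '' {g | g ∈ Q} = Set.range fun i : Fin Q.length => (Q.get i).toReal := by
    ext x
    simp only [Set.mem_image, Set.mem_ofPred_eq, Set.mem_range, List.mem_iff_get]
    constructor
    · rintro ⟨g, ⟨i, rfl⟩, rfl⟩; exact ⟨i, rfl⟩
    · rintro ⟨i, rfl⟩; exact ⟨_, ⟨i, rfl⟩, rfl⟩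
  rw [cone, hr, Submodule.mem_span_range_iff_exists_fun] at hα
  obtain ⟨c, rfl⟩ := hα
  have hs : ∑ i, (c i : ℝ) * ((Q.get i).dot h : ℤ) = h.toReal ⬝ᵥ ∑ i, c i • (Q.get i).toReal := by
    rw [dotProduct_sum]
    refine Finset.sum_congr rfl fun i _ => ?_
    rw [← IntVec.toReal_dotProduct_toReal, dotProduct_comm, NNReal.smul_def, dotProduct_smul,
      smul_eq_mul]
  refine sum_mem_of_crossings_mem C (fun i => (Q.get i).toReal) (fun i => c i)
    (fun i => (c i).2) (fun i => ((Q.get i).dot h : ℤ)) (hs ▸ hsum) ?_ ?_ ?_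
  · intro i hi
    refine hcut _ (List.mem_append_left _ (List.mem_filter.2 ⟨List.get_mem _ _, ?_⟩))
    rw [isZero_iff]; exact_mod_cast hi
  · intro h0 i hi
    exact hpos (hs ▸ h0) _ (List.get_mem _ _) (by exact_mod_cast hi)
  · intro i j hi hj
    have := hcut (IntVec.comb ((Q.get i).dot h) (Q.get j) (Int.neg ((Q.get j).dot h)) (Q.get i))
      (List.mem_append_right _ (List.mem_flatMap.2 ⟨Q.get i, List.mem_filter.2
        ⟨List.get_mem _ _, (isPos_iff _).2 (by exact_mod_cast hi)⟩, List.mem_map.2 ⟨Q.get j,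
        List.mem_filter.2 ⟨List.get_mem _ _, (isNeg_iff _).2 (by exact_mod_cast hj)⟩, rfl⟩⟩))
    rw [IntVec.toReal_comb] at this
    exact_mod_cast this

theorem mem_cone_cut {Q : List IntVec} {h : IntVec} {α : Fin 5 → ℝ} (hα : α ∈ cone Q)
    (hh : h.toReal ⬝ᵥ α = 0) : α ∈ cone (cut Q h) :=
  mem_span_of_crossings hα _ hh.ge (fun _ hp => toReal_mem_cone hp) fun h0 => (h0.ne' hh).elim

def halfCut (Q : List IntVec) (h : IntVec) : List IntVec :=
  cut Q h ++ Q.filter fun p => isPos (p.dot h)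

theorem mem_cone_halfCut {Q : List IntVec} {h : IntVec} {α : Fin 5 → ℝ} (hα : α ∈ cone Q)
    (hh : 0 ≤ h.toReal ⬝ᵥ α) : α ∈ cone (halfCut Q h) :=
  mem_span_of_crossings hα _ hh (fun _ hp => toReal_mem_cone (List.mem_append_left _ hp))
    fun _ _ hp h0 => toReal_mem_cone (List.mem_append_right _ (List.mem_filter.2
      ⟨hp, (isPos_iff _).2 h0⟩))

/-- A form that is positive on all generators is positive on every nonzero element of the cone.
Applied to an excess vector orthogonal to α, this yields the generator p that makes the search
finite. -/
theorem exists_mem_dot_nonpos {Q : List IntVec} {h α : Fin 5 → ℝ} (hα : α ∈ cone Q)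
    (hh : h ⬝ᵥ α ≤ 0) (h0 : α ≠ 0) : ∃ p ∈ Q, h ⬝ᵥ p.toReal ≤ 0 := by
  by_contra! hc
  have key : α = 0 ∨ 0 < h ⬝ᵥ α := by
    clear hh h0
    induction hα using Submodule.span_induction with
    | mem x hx => obtain ⟨g, hg, rfl⟩ := hx; exact .inr (hc g hg)
    | zero => exact .inl rfl
    | add x y _ _ hx hy =>
      rcases hx with rfl | hx <;> rcases hy with rfl | hy
      · simp
      · simpa using .inr hy
      · simpa using .inr hx
      · right; rw [dotProduct_add]; exact add_pos hx hy
    | smul t x _ hx =>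
      rcases hx with rfl | hx
      · simp
      rcases eq_or_ne t 0 with rfl | ht
      · simp
      · right
        rw [NNReal.smul_def, dotProduct_smul]
        exact mul_pos (NNReal.coe_pos.2 (pos_iff_ne_zero.2 ht)) hx
  rcases key with h1 | h1
  · exact h0 h1
  · exact hh.not_gt h1

theorem exists_mem_dot_pos {Q : List IntVec} {h α : Fin 5 → ℝ} (hα : α ∈ cone Q)
    (hh : 0 < h ⬝ᵥ α) : ∃ p ∈ Q, 0 < h ⬝ᵥ p.toReal := by
  by_contra! hc
  refine hh.not_ge ?_
  clear hh
  induction hα using Submodule.span_induction with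
  | mem x hx => obtain ⟨g, hg, rfl⟩ := hx; exact hc g hg
  | zero => simp
  | add x y _ _ hx hy => rw [dotProduct_add]; exact add_nonpos hx hy
  | smul t x _ hx =>
    rw [NNReal.smul_def, dotProduct_smul]
    exact mul_nonpos_of_nonneg_of_nonpos t.2 hx

/-- Some element of `Q` has a positive value at each of the ten linear forms that are positive on
vectors with coordinates in `]0, 1[` and coordinate sum `3`. -/
def meetsInterior (Q : List IntVec) : Bool :=
  Q.any (fun p => isPos p.a) && Q.any (fun p => isPos p.b) && Q.any (fun p => isPos p.c) &&
  Q.any (fun p => isPos p.d) && Q.any (fun p => isPos p.e) &&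
  Q.any (fun p => isPos (p.sum.sub (Int.mul 3 p.a))) &&
  Q.any (fun p => isPos (p.sum.sub (Int.mul 3 p.b))) &&
  Q.any (fun p => isPos (p.sum.sub (Int.mul 3 p.c))) &&
  Q.any (fun p => isPos (p.sum.sub (Int.mul 3 p.d))) &&
  Q.any (fun p => isPos (p.sum.sub (Int.mul 3 p.e)))

/-- The condition α i < 1 becomes homogeneous as ∑ α − 3 α i > 0, because the sum is 3. A form that
is positive at a point of the cone is positive at some generator. Only this necessary condition is
needed, to discard candidates. -/
theorem meetsInterior_of_mem_cone {Q : List IntVec} {α : Fin 5 → ℝ} (hα : α ∈ cone Q)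
    (hsum : ∑ i, α i = 3) (h : ∀ i, 0 < α i ∧ α i < 1) : meetsInterior Q = true := by
  have h1 : ∀ i, ∃ p ∈ Q, 0 < p.get i := by
    intro i
    obtain ⟨p, hp, hi⟩ := exists_mem_dot_pos (h := Pi.single i 1) hα (by simp [(h i).1])
    refine ⟨p, hp, ?_⟩
    rw [single_one_dotProduct, IntVec.toReal_apply] at hi
    exact_mod_cast hi
  have h2 : ∀ i, ∃ p ∈ Q, 0 < p.sum - 3 * p.get i := by
    intro i
    obtain ⟨p, hp, hi⟩ := exists_mem_dot_pos (h := 1 - Pi.single i 3) hα (by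
      rw [sub_dotProduct, one_dotProduct, hsum, single_dotProduct]; linarith [(h i).2])
    refine ⟨p, hp, ?_⟩
    rw [sub_dotProduct, one_dotProduct, single_dotProduct, IntVec.sum_toReal,
      IntVec.toReal_apply] at hi
    exact_mod_cast hi
  simp only [meetsInterior, Bool.and_eq_true, List.any_eq_true, isPos_iff]
  exact ⟨⟨⟨⟨⟨⟨⟨⟨⟨h1 0, h1 1⟩, h1 2⟩, h1 3⟩, h1 4⟩, h2 0⟩, h2 1⟩, h2 2⟩, h2 3⟩, h2 4⟩

/-! ### Excess vectors -/

/-- The vector `3 w - 2`; it is orthogonal to `α` with coordinate sum `3` iff `α · w = 2`. -/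
def excess (w : Fin 5 → ℕ) : Fin 5 → ℝ := fun i => 3 * w i - 2

def IsPerp (X : Set (Fin 5 → ℕ)) (β : Fin 5 → ℝ) : Prop := ∀ w ∈ X, excess w ⬝ᵥ β = 0

def excessVec (a b c d e : ℕ) : IntVec :=
  ⟨Int.subNatNat (Nat.mul 3 a) 2, Int.subNatNat (Nat.mul 3 b) 2, Int.subNatNat (Nat.mul 3 c) 2,
    Int.subNatNat (Nat.mul 3 d) 2, Int.subNatNat (Nat.mul 3 e) 2⟩

theorem toReal_excessVec (w : Fin 5 → ℕ) :
    (excessVec (w 0) (w 1) (w 2) (w 3) (w 4)).toReal = excess w := by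
  ext i
  fin_cases i <;> simp [excessVec, IntVec.toReal, excess, Int.subNatNat_eq_coe]

def ofDigits (n : ℕ) : IntVec :=
  excessVec (n / 10000 % 10) (n / 1000 % 10) (n / 100 % 10) (n / 10 % 10) (n % 10)

theorem toReal_ofDigits (n : ℕ) : (ofDigits n).toReal = excess (digitVec n) := by
  rw [← toReal_excessVec]
  simp [digitVec, ofDigits]

def tableVecs (k : ℕ) : List IntVec := (table.getD (k - 1) []).map ofDigits

theorem isPerp_B (k : ℕ) (β : Fin 5 → ℝ) : IsPerp (B k) β ↔ IsOrth (tableVecs k) β := by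
  simp only [IsPerp, B, IsOrth, tableVecs, List.forall_mem_map, toReal_ofDigits, Set.mem_ofPred_eq,
    forall_exists_index, and_imp]
  exact ⟨fun h n hn => h _ n hn rfl, fun h w n hn hw => hw ▸ h n hn⟩

/-- Permutations are coded by numerals whose digits 0 to 4 are the images of the positions, counted
from 0. -/
def digitFun (n : ℕ) : Fin 5 → Fin 5 := fun i => Fin.ofNat 5 (digitVec n i)

def IntVec.coord (x : IntVec) : ℕ → ℤ
  | 0 => x.a
  | 1 => x.b
  | 2 => x.c
  | 3 => x.d
  | _ => x.e

/-- The coordinates of `x` in the order given by the digits of `n`. -/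
def IntVec.permute (n : ℕ) (x : IntVec) : IntVec :=
  ⟨x.coord (n / 10000 % 10 % 5), x.coord (n / 1000 % 10 % 5), x.coord (n / 100 % 10 % 5),
    x.coord (n / 10 % 10 % 5), x.coord (n % 10 % 5)⟩

theorem IntVec.toReal_eq_coord (x : IntVec) (i : Fin 5) : x.toReal i = x.coord i := by
  fin_cases i <;> rfl

theorem IntVec.toReal_permute (n : ℕ) (x : IntVec) :
    (x.permute n).toReal = x.toReal ∘ digitFun n := by
  ext i
  rw [Function.comp_apply, IntVec.toReal_eq_coord x]
  fin_cases i <;> simp [IntVec.permute, IntVec.toReal, digitFun, digitVec, Fin.ofNat]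

/-! ### The search -/

/-- `y + t p` for the least `t ≤ n` that makes it positive. -/
def posShift (y p : IntVec) : ℕ → Option IntVec
  | 0 => none
  | n + 1 =>
    if isPos y.a && isPos y.b && isPos y.c && isPos y.d && isPos y.e then some y
    else posShift (y.add p) p n

theorem posShift_spec {y p c : IntVec} {n : ℕ} (h : posShift y p n = some c) :
    (0 < c.a ∧ 0 < c.b ∧ 0 < c.c ∧ 0 < c.d ∧ 0 < c.e) ∧
      ∃ t : ℕ, c.toReal = y.toReal + (t : ℝ) • p.toReal := by
  induction n generalizing y with
  | zero => simp [posShift] at h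
  | succ n ih =>
    rw [posShift] at h
    split at h
    · next hp =>
      simp only [Bool.and_eq_true, isPos_iff] at hp
      cases h
      exact ⟨by tauto, 0, by simp⟩
    · obtain ⟨hc, t, ht⟩ := ih h
      refine ⟨hc, t + 1, ?_⟩
      rw [ht, IntVec.toReal_add]
      push_cast
      module

def allUpTo : ℕ → (ℕ → Bool) → Bool
  | 0, f => f 0
  | n + 1, f => f (Nat.succ n) && allUpTo n f

theorem allUpTo_spec {n : ℕ} {f : ℕ → Bool} (h : allUpTo n f = true) {k : ℕ} (hk : k ≤ n) :
    f k = true := by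
  induction n with
  | zero => rw [Nat.le_zero.1 hk]; exact h
  | succ n ih =>
    rw [allUpTo, Bool.and_eq_true] at h
    rcases Nat.le_succ_iff.1 hk with h' | rfl
    · exact ih h.2 h'
    · exact h.1

/-- `f` holds at all excess vectors that have a negative product with the positive vector `c`. -/
def simplexAll (c : IntVec) (f : IntVec → Bool) : Bool :=
  forceNat c.a.toNat fun a => forceNat c.b.toNat fun b => forceNat c.c.toNat fun c₂ =>
  forceNat c.d.toNat fun d => forceNat c.e.toNat fun e =>
  -- The condition is 3 (c·w) < 2 ∑ c, that is, c·w ≤ ⌊(2 ∑ c − 1)/3⌋. Since c is positive, each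
  -- coordinate of w is bounded by what the previous ones leave of this budget.
  forceNat (Nat.div (Nat.sub (Nat.mul 2 c.sum.toNat) 1) 3) fun m =>
  allUpTo (Nat.div m a) fun w₀ => forceNat (Nat.sub m (Nat.mul a w₀)) fun m =>
  allUpTo (Nat.div m b) fun w₁ => forceNat (Nat.sub m (Nat.mul b w₁)) fun m =>
  allUpTo (Nat.div m c₂) fun w₂ => forceNat (Nat.sub m (Nat.mul c₂ w₂)) fun m =>
  allUpTo (Nat.div m d) fun w₃ => forceNat (Nat.sub m (Nat.mul d w₃)) fun m =>
  allUpTo (Nat.div m e) fun w₄ => (excessVec w₀ w₁ w₂ w₃ w₄).force f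

theorem simplexAll_spec {c : IntVec} {f : IntVec → Bool}
    (hc : 0 < c.a ∧ 0 < c.b ∧ 0 < c.c ∧ 0 < c.d ∧ 0 < c.e) (h : simplexAll c f = true)
    {w : Fin 5 → ℕ} (hw : excess w ⬝ᵥ c.toReal < 0) :
    f (excessVec (w 0) (w 1) (w 2) (w 3) (w 4)) = true := by
  obtain ⟨a, b, c, d, e⟩ := c
  obtain ⟨ha, hb, hc, hd, he⟩ := hc
  dsimp only at ha hb hc hd he
  lift a to ℕ using ha.le
  lift b to ℕ using hb.le
  lift c to ℕ using hc.le
  lift d to ℕ using hd.le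
  lift e to ℕ using he.le
  norm_cast at ha hb hc hd he
  have key : 3 * (a * w 0 + b * w 1 + c * w 2 + d * w 3 + e * w 4) < 2 * (a + b + c + d + e) := by
    simp only [dotProduct, Fin.sum_univ_five, excess, IntVec.toReal] at hw
    have : (3 * (a * w 0 + b * w 1 + c * w 2 + d * w 3 + e * w 4) : ℝ)
        < 2 * (a + b + c + d + e) := by
      simp at hw
      linarith
    exact_mod_cast this
  simp only [simplexAll, Int.toNat_natCast, IntVec.sum_eq, IntVec.force_eq, forceNat_eq,
    show ∀ m n : ℕ, Nat.div m n = m / n from fun _ _ => rfl, Nat.sub_eq, Nat.mul_eq] at h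
  have hm : ((a : ℤ) + (b + (c + (d + e)))).toNat = a + b + c + d + e := by omega
  rw [hm] at h
  set m := (2 * (a + b + c + d + e) - 1) / 3 with hmdef
  have hle : a * w 0 + b * w 1 + c * w 2 + d * w 3 + e * w 4 ≤ m := by omega
  clear_value m
  have h0 := allUpTo_spec h (k := w 0) (by rw [Nat.le_div_iff_mul_le ha, mul_comm]; omega)
  have h1 := allUpTo_spec h0 (k := w 1) (by rw [Nat.le_div_iff_mul_le hb, mul_comm]; omega)
  have h2 := allUpTo_spec h1 (k := w 2) (by rw [Nat.le_div_iff_mul_le hc, mul_comm]; omega)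
  have h3 := allUpTo_spec h2 (k := w 3) (by rw [Nat.le_div_iff_mul_le hd, mul_comm]; omega)
  exact allUpTo_spec h3 (k := w 4) (by rw [Nat.le_div_iff_mul_le he, mul_comm]; omega)

/-! ### The cone of sorted angle vectors and normalization of generators -/

def orderGens : List IntVec :=
  [⟨1, 1, 1, 1, 1⟩, ⟨0, 1, 1, 1, 1⟩, ⟨0, 0, 1, 1, 1⟩, ⟨0, 0, 0, 1, 1⟩, ⟨0, 0, 0, 0, 1⟩]

/-- The coefficients are the successive increments of α, which are nonnegative. -/
theorem mem_cone_orderGens {α : Fin 5 → ℝ} (h : Monotone α) (h0 : 0 ≤ α 0) :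
    α ∈ cone orderGens := by
  have : α = α 0 • (⟨1, 1, 1, 1, 1⟩ : IntVec).toReal
      + (α 1 - α 0) • (⟨0, 1, 1, 1, 1⟩ : IntVec).toReal
      + (α 2 - α 1) • (⟨0, 0, 1, 1, 1⟩ : IntVec).toReal
      + (α 3 - α 2) • (⟨0, 0, 0, 1, 1⟩ : IntVec).toReal
      + (α 4 - α 3) • (⟨0, 0, 0, 0, 1⟩ : IntVec).toReal := by
    ext i; fin_cases i <;> simp [IntVec.toReal]
  rw [this]
  have hm : ∀ i j : Fin 5, i ≤ j → 0 ≤ α j - α i := fun i j hij => sub_nonneg.2 (h hij)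
  refine add_mem (add_mem (add_mem (add_mem ?_ ?_) ?_) ?_) ?_ <;>
    refine smul_mem_of_nonneg _ ?_ (toReal_mem_cone (by simp [orderGens]))
  · exact h0
  all_goals exact hm _ _ (by decide)

def gcdNormalize (p : IntVec) : IntVec :=
  let g : ℤ := Nat.gcd p.a.natAbs (Nat.gcd p.b.natAbs (Nat.gcd p.c.natAbs
    (Nat.gcd p.d.natAbs p.e.natAbs)))
  ⟨p.a / g, p.b / g, p.c / g, p.d / g, p.e / g⟩

/-- The factor is only claimed nonnegative: for p = 0 the gcd is 0, and division by 0 returns 0. -/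
theorem toReal_gcdNormalize (p : IntVec) :
    ∃ g : ℝ, 0 ≤ g ∧ p.toReal = g • (gcdNormalize p).toReal := by
  set g : ℤ := ((Nat.gcd p.a.natAbs (Nat.gcd p.b.natAbs (Nat.gcd p.c.natAbs
    (Nat.gcd p.d.natAbs p.e.natAbs))) : ℕ) : ℤ) with hg
  refine ⟨(g : ℤ), by positivity, ?_⟩
  have h1 : g ∣ p.a := Int.natCast_dvd.2 (Nat.gcd_dvd_left _ _)
  have r1 : (g : ℤ).natAbs ∣ _ := Nat.gcd_dvd_right _ _
  have h2 : g ∣ p.b := Int.natCast_dvd.2 (r1.trans (Nat.gcd_dvd_left _ _))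
  have r2 := r1.trans (Nat.gcd_dvd_right _ _)
  have h3 : g ∣ p.c := Int.natCast_dvd.2 (r2.trans (Nat.gcd_dvd_left _ _))
  have r3 := r2.trans (Nat.gcd_dvd_right _ _)
  have h4 : g ∣ p.d := Int.natCast_dvd.2 (r3.trans (Nat.gcd_dvd_left _ _))
  have h5 : g ∣ p.e := Int.natCast_dvd.2 (r3.trans (Nat.gcd_dvd_right _ _))
  have key : ∀ z : ℤ, g ∣ z → (z : ℝ) = (g : ℝ) * ((z / g : ℤ) : ℝ) := fun z hz => by
    rw [← Int.cast_mul, Int.mul_ediv_cancel' hz]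
  ext i
  fin_cases i
  exacts [key _ h1, key _ h2, key _ h3, key _ h4, key _ h5]

def IntVec.beq (x y : IntVec) : Bool :=
  isZero (x.a.sub y.a) && isZero (x.b.sub y.b) && isZero (x.c.sub y.c) && isZero (x.d.sub y.d) &&
    isZero (x.e.sub y.e)

theorem IntVec.eq_of_beq {x y : IntVec} (h : x.beq y = true) : x = y := by
  simp only [IntVec.beq, Bool.and_eq_true, isZero_iff,
    show ∀ m n : ℤ, Int.sub m n = m - n from fun _ _ => rfl, sub_eq_zero] at h
  cases x; cases y
  simp_all

def insertNew (p : IntVec) (Q : List IntVec) : List IntVec :=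
  if Q.any p.beq then Q else p :: Q

/-- Normalized generators without repetitions. -/
def compress (Q : List IntVec) : List IntVec :=
  Q.foldr (fun p acc => insertNew (p.force gcdNormalize) acc) []

theorem mem_insertNew_self (p : IntVec) (Q : List IntVec) : p ∈ insertNew p Q := by
  unfold insertNew
  split
  · next h =>
    obtain ⟨q, hq, h⟩ := List.any_eq_true.1 h
    rwa [IntVec.eq_of_beq h]
  · exact List.mem_cons_self

theorem mem_insertNew_of_mem {p q : IntVec} {Q : List IntVec} (h : q ∈ Q) :
    q ∈ insertNew p Q := by
  unfold insertNew
  split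
  · exact h
  · exact List.mem_cons_of_mem _ h

theorem gcdNormalize_mem_compress {Q : List IntVec} {p : IntVec} (h : p ∈ Q) :
    gcdNormalize p ∈ compress Q := by
  simp only [compress, IntVec.force_eq]
  induction Q with
  | nil => simp at h
  | cons q Q ih =>
    rcases List.mem_cons.1 h with rfl | h
    · exact mem_insertNew_self _ _
    · exact mem_insertNew_of_mem (ih h)

theorem cone_le_cone_compress (Q : List IntVec) : cone Q ≤ cone (compress Q) := by
  refine Submodule.span_le.2 ?_
  rintro _ ⟨p, hp, rfl⟩
  obtain ⟨g, hg, h⟩ := toReal_gcdNormalize p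
  rw [h]
  exact smul_mem_of_nonneg _ hg (toReal_mem_cone (gcdNormalize_mem_compress hp))

/-- Generators of the cone over the sorted vectors `α` with coordinates in `[0, 1]` and coordinate
sum `3` that are orthogonal to `V`. -/
def region : List IntVec → List IntVec
  -- The product with (1, 1, 1, 1, −2) is ∑ α − 3 α 4, so the half-space encodes α 4 ≤ 1. As α is
  -- sorted, this bounds all coordinates.
  | [] => compress (halfCut orderGens ⟨1, 1, 1, 1, -2⟩)
  | v :: V => forceList (region V) fun Q => compress (cut Q v)

/-! ### Nodes of the search and their checks -/

structure Node where
  /-- the known elements of `𝒳` -/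
  vecs : List ℕ
  /-- the vectors `y` such that `𝒳` is orthogonal to `y` or has an element with `y · w < 0` -/
  tests : List IntVec
  /-- the positions of the nodes to which the second case leads, in the list that follows -/
  children : List ℕ
  /-- the index `k` and the digits of the permutation that identify `𝒳` if it is orthogonal to all
  `tests`; absent if this is impossible -/
  leaf : Option (ℕ × ℕ)

def Node.vectors (n : Node) : List IntVec := n.vecs.map ofDigits

/-- Four ways to settle a candidate: it does not have a negative product with y; it contradicts
orthogonality to an earlier test in U; it leaves no interior angle vector in the cone; or the known
vectors together with w span those of a child. The child may forget vectors of its parent. -/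
def candidateOk (y : IntVec) (U Q N : List IntVec) (children : List (List IntVec))
    (w : IntVec) : Bool :=
  !isNeg (w.dot y) || U.any (fun u => !isZero (w.dot u)) || !forceList (cut Q w) meetsInterior ||
    forceList (reduceBy N w) fun G => children.any (allOrth G)

/-- `f` holds at all excess vectors `w` such that `w · y < 0` and `w · p ≤ 0` for some `p`. -/
def searchAll (y : IntVec) (f : IntVec → Bool) : List IntVec → Bool
  | [] => true
  | p :: Q =>
    -- The values t = 0, …, 12 are tried. The bound is merely large enough for the certificate, as a
    -- failure makes the check fail.
    (match posShift y p 13 with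
      | none => false
      | some c => c.force fun c => simplexAll c fun w =>
        -- Each w is charged to the last generator with w · p ≤ 0, so it is skipped if a later
        -- generator also qualifies.
        isPos (w.dot p) || Q.any (fun q => !isPos (w.dot q)) || f w) && searchAll y f Q

/-- For the last generator p with product ≤ 0, the product with y + t p is still negative. As y + t
p is positive in all coordinates, w lies in the finite simplex that was enumerated. -/
theorem searchAll_spec {y : IntVec} {f : IntVec → Bool} {Q : List IntVec}
    (h : searchAll y f Q = true) {w : Fin 5 → ℕ} (hy : excess w ⬝ᵥ y.toReal < 0)
    (hQ : ∃ p ∈ Q, excess w ⬝ᵥ p.toReal ≤ 0) :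
    f (excessVec (w 0) (w 1) (w 2) (w 3) (w 4)) = true := by
  induction Q with
  | nil => simp at hQ
  | cons p Q ih =>
    rw [searchAll, Bool.and_eq_true] at h
    by_cases hex : ∃ p ∈ Q, excess w ⬝ᵥ p.toReal ≤ 0
    · exact ih h.2 hex
    have hp : excess w ⬝ᵥ p.toReal ≤ 0 := by
      obtain ⟨q, hq, hq0⟩ := hQ
      rcases List.mem_cons.1 hq with rfl | hq
      · exact hq0
      · exact (hex ⟨q, hq, hq0⟩).elim
    have h1 := h.1
    split at h1
    · simp at h1
    next c hc =>
    obtain ⟨hpos, t, ht⟩ := posShift_spec hc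
    rw [IntVec.force_eq] at h1
    have h2 := simplexAll_spec hpos h1 (w := w) (by
      rw [ht, dotProduct_add, dotProduct_smul]
      exact add_neg_of_neg_of_nonpos hy (mul_nonpos_of_nonneg_of_nonpos t.cast_nonneg hp))
    simp only [← toReal_excessVec, IntVec.toReal_dotProduct_toReal] at hp hex
    simp only [Bool.or_eq_true, isPos_iff, List.any_eq_true, Bool.not_eq_true',
      ← Bool.not_eq_true] at h2
    rcases h2 with (h2 | ⟨q, hq, hq0⟩) | h2
    · exact (h2.not_ge (by exact_mod_cast hp)).elim
    · exact (hex ⟨q, hq, by exact_mod_cast not_lt.1 hq0⟩).elim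
    · exact h2

def testOk (y : IntVec) (U Q N : List IntVec) (children : List (List IntVec)) : Bool :=
  searchAll y (candidateOk y U Q N children) Q

/-- The order of the tests matters: once a test is passed, 𝒳 is known to be orthogonal to it, and it
joins U to exclude candidates of later tests. -/
def testsOk (Q N : List IntVec) (children : List (List IntVec)) :
    List IntVec → List IntVec → Bool
  | _, [] => true
  | U, y :: ys => testOk y U Q N children && testsOk Q N children (y :: U) ys

/-- The digits of `n` are those of a permutation. -/
def isPermDigits (n : ℕ) : Bool := decide (Function.Injective (digitFun n))

/-- Without a leaf, some test y must be incompatible with 𝒳 ⊥ y, either through V or modulo 3. With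
a leaf, the last two conditions say that V and the permuted ℬₖ have the same complement, and the
condition on `reduceBy N ⟨1, 1, 1, 1, 1⟩` that U^⊥ is orthogonal to the vectors of V^⊥ with
coordinate sum 0. -/
def endOk (classes : List ℕ) (V N U : List IntVec) : Option (ℕ × ℕ) → Bool
  | none => U.any fun y => V.any (fun v => !isZero (y.dot v)) || !isZero (y.sum % 3)
  | some (k, p) =>
    forceList ((tableVecs k).map (IntVec.permute p)) fun S =>
    classes.any (Nat.beq k) && isPermDigits p &&
      (forceList (nullGens U) fun G => allOrth G (reduceBy N ⟨1, 1, 1, 1, 1⟩)) &&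
      allOrth N S && forceList (nullGens S) fun G => allOrth G V

def nodeOk (classes : List ℕ) (n : Node) (rest : List Node) : Bool :=
  forceList n.vectors fun V => forceList (nullGens V) fun N =>
    (forceList (region V) fun Q =>
      forceLists (n.children.filterMap fun i => rest[i]?.map Node.vectors) fun children =>
      testsOk Q N children [] n.tests) &&
    endOk classes V N n.tests n.leaf

def nodesOk (classes : List ℕ) : List Node → Bool
  | [] => true
  | n :: rest => nodeOk classes n rest && nodesOk classes rest

/-! ### Soundness of the search -/

/-- The hypotheses in the form used by the search, after sorting. In `good` the test vector has no
condition on its coordinate sum. -/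
structure Admissible (X : Set (Fin 5 → ℕ)) (α : Fin 5 → ℝ) : Prop where
  nonempty : X.Nonempty
  good : ∀ y : Fin 5 → ℝ, IsPerp X y ∨ ∃ w ∈ X, excess w ⬝ᵥ y < 0
  perp : IsPerp X α
  sum : ∑ i, α i = 3
  interior : ∀ i, 0 < α i ∧ α i < 1
  sorted : Monotone α

theorem Admissible.ne_zero {X : Set (Fin 5 → ℕ)} {α : Fin 5 → ℝ} (h : Admissible X α) : α ≠ 0 :=
  fun h0 => by simpa [h0] using h.interior 0

theorem Admissible.mem_region {X : Set (Fin 5 → ℕ)} {α : Fin 5 → ℝ} (h : Admissible X α)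
    {V : List IntVec} (hV : IsOrth V α) : α ∈ cone (region V) := by
  induction V with
  | nil =>
    refine cone_le_cone_compress _ (mem_cone_halfCut
      (mem_cone_orderGens h.sorted (h.interior 0).1.le) ?_)
    have h1 := h.sum
    have h2 := (h.interior 4).2
    simp only [Fin.sum_univ_five] at h1
    simp only [dotProduct, Fin.sum_univ_five, IntVec.toReal]
    simp
    linarith
  | cons v V ih =>
    rw [region, forceList_eq]
    exact cone_le_cone_compress _ (mem_cone_cut (ih fun u hu => hV u (List.mem_cons_of_mem _ hu))
      (hV v List.mem_cons_self))

/-- Classification up to all of S₅, and only up to the orthogonal complement, which determines the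
polytope. -/
def IsClassified (classes : List ℕ) (X : Set (Fin 5 → ℕ)) : Prop :=
  ∃ k ∈ classes, ∃ p : ℕ, Function.Injective (digitFun p) ∧
    ∀ β, IsPerp X β ↔ IsOrth ((tableVecs k).map (IntVec.permute p)) β

/-- All admissible sets that contain `V` up to linear combinations are classified. -/
def Settled (classes : List ℕ) (V : List IntVec) : Prop :=
  ∀ X α, Admissible X α → (∀ β, IsPerp X β → IsOrth V β) → IsClassified classes X

variable {classes : List ℕ} {X : Set (Fin 5 → ℕ)} {α : Fin 5 → ℝ}

/-- If 𝒳 is not orthogonal to y, goodness gives w in 𝒳 with a negative product. The search has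
covered it, and since w is orthogonal to α and to the vectors of U, the only remaining outcome is a
child that is already settled. -/
theorem testOk_spec {y : IntVec} {U Q N : List IntVec} {children : List (List IntVec)}
    (h : testOk y U Q N children = true) (hX : Admissible X α) (hα : α ∈ cone Q)
    (hU : ∀ u ∈ U, IsPerp X u.toReal) (hN : ∀ β, IsPerp X β → β ∈ linSpan N)
    (hch : ∀ V ∈ children, Settled classes V) : IsPerp X y.toReal ∨ IsClassified classes X := by
  refine (hX.good y.toReal).imp_right ?_
  rintro ⟨w, hw, hneg⟩
  have h2 := searchAll_spec h hneg
    (exists_mem_dot_nonpos hα (hX.perp w hw).le hX.ne_zero)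
  have hW := toReal_excessVec w
  set W := excessVec (w 0) (w 1) (w 2) (w 3) (w 4)
  simp only [candidateOk, forceList_eq, Bool.or_eq_true, Bool.not_eq_true', List.any_eq_true] at h2
  rcases h2 with ((h2 | ⟨u, hu, h2⟩) | h2) | ⟨V, hV, h2⟩
  · rw [← Bool.not_eq_true, isNeg_iff] at h2
    rw [← hW, IntVec.toReal_dotProduct_toReal] at hneg
    exact (h2 (by exact_mod_cast hneg)).elim
  · rw [← Bool.not_eq_true, isZero_iff] at h2
    have := hU u hu w hw
    rw [← hW, IntVec.toReal_dotProduct_toReal] at this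
    exact (h2 (by exact_mod_cast this)).elim
  · rw [meetsInterior_of_mem_cone (mem_cone_cut hα (by rw [hW]; exact hX.perp w hw)) hX.sum
      hX.interior] at h2
    simp at h2
  · exact hch V hV X α hX fun β hβ =>
      isOrth_of_mem_linSpan h2 (mem_linSpan_reduceBy (hN β hβ) (by rw [hW]; exact hβ w hw))

theorem testsOk_spec {U ys Q N : List IntVec} {children : List (List IntVec)}
    (h : testsOk Q N children U ys = true) (hX : Admissible X α) (hα : α ∈ cone Q)
    (hU : ∀ u ∈ U, IsPerp X u.toReal) (hN : ∀ β, IsPerp X β → β ∈ linSpan N)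
    (hch : ∀ V ∈ children, Settled classes V) :
    (∀ y ∈ ys, IsPerp X y.toReal) ∨ IsClassified classes X := by
  induction ys generalizing U with
  | nil => simp
  | cons y ys ih =>
    rw [testsOk, Bool.and_eq_true] at h
    rcases testOk_spec h.1 hX hα hU hN hch with h1 | h1
    · have hU' : ∀ u ∈ y :: U, IsPerp X u.toReal := by
        simpa only [List.forall_mem_cons] using ⟨h1, hU⟩
      refine (ih h.2 hU').imp_left fun h2 => ?_
      simpa only [List.forall_mem_cons] using ⟨h1, h2⟩
    · exact .inr h1

theorem isOrth_toReal {V : List IntVec} {y : IntVec} :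
    IsOrth V y.toReal ↔ ∀ v ∈ V, y.dot v = 0 := by
  refine forall₂_congr fun v _ => ?_
  rw [dotProduct_comm, IntVec.toReal_dotProduct_toReal]
  exact_mod_cast Iff.rfl

/-- For w in 𝒳, orthogonality reads 3 (w·y) = 2 ∑ y. -/
theorem three_dvd_sum_of_isPerp (hne : X.Nonempty) {y : IntVec} (h : IsPerp X y.toReal) :
    y.sum % 3 = 0 := by
  obtain ⟨w, hw⟩ := hne
  have := h w hw
  rw [← toReal_excessVec, IntVec.toReal_dotProduct_toReal] at this
  have h0 : (excessVec (w 0) (w 1) (w 2) (w 3) (w 4)).dot y = 0 := by exact_mod_cast this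
  simp only [IntVec.dot_eq, excessVec, Int.subNatNat_eq_coe, Nat.mul_eq] at h0
  push_cast at h0
  refine Int.emod_eq_zero_of_dvd ⟨IntVec.sum y - (w 0 * y.a + w 1 * y.b + w 2 * y.c + w 3 * y.d
    + w 4 * y.e), ?_⟩
  simp only [IntVec.sum_eq]
  linarith

/-- At a leaf V^⊥ must be shown to lie in 𝒳^⊥. Every β in V^⊥ is a multiple of α plus a vector of
V^⊥ with coordinate sum 0. The excess vectors of 𝒳 are orthogonal to α, and being in U^⊥ they are
orthogonal to the second summand by the certificate. -/
theorem endOk_spec {V U : List IntVec} {leaf : Option (ℕ × ℕ)}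
    (h : endOk classes V (nullGens V) U leaf = true) (hX : Admissible X α)
    (hU : ∀ u ∈ U, IsPerp X u.toReal) (hV : ∀ β, IsPerp X β → IsOrth V β) :
    IsClassified classes X := by
  rcases leaf with _ | ⟨k, p⟩
  · simp only [endOk, Bool.or_eq_true, Bool.not_eq_true', List.any_eq_true,
      ← Bool.not_eq_true, isZero_iff] at h
    obtain ⟨y, hy, ⟨v, hv, h⟩ | h⟩ := h
    · exact (h (isOrth_toReal.1 (hV _ (hU y hy)) v hv)).elim
    · exact (h (three_dvd_sum_of_isPerp hX.nonempty (hU y hy))).elim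
  · simp only [endOk, forceList_eq, Bool.and_eq_true, List.any_eq_true] at h
    obtain ⟨⟨⟨⟨⟨k', hk, hkk⟩, hp⟩, h1⟩, h2⟩, h3⟩ := h
    obtain rfl := Nat.eq_of_beq_eq_true hkk
    refine ⟨k, hk, p, of_decide_eq_true hp, fun β => ?_⟩
    refine ⟨fun hβ => isOrth_of_mem_linSpan h2 (hV β hβ).mem_linSpan, fun hβ => ?_⟩
    have hβV := isOrth_of_mem_linSpan h3 hβ.mem_linSpan
    -- As ∑ α = 3, this t makes the coordinate sum of β − t α vanish.
    set t := (∑ i, β i) / 3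
    have hdiff : β - t • α ∈ linSpan (reduceBy (nullGens V) ⟨1, 1, 1, 1, 1⟩) := by
      refine mem_linSpan_reduceBy (IsOrth.mem_linSpan fun v hv => ?_) ?_
      · rw [dotProduct_sub, dotProduct_smul, hβV v hv, hV α hX.perp v hv, smul_zero, sub_zero]
      · have hone : (⟨1, 1, 1, 1, 1⟩ : IntVec).toReal = 1 := by
          ext i; fin_cases i <;> simp [IntVec.toReal]
        rw [hone, one_dotProduct]
        simp only [Pi.sub_apply, Pi.smul_apply, smul_eq_mul, Finset.sum_sub_distrib,
          ← Finset.mul_sum, hX.sum, t]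
        ring
    intro w hw
    have hwU : excess w ∈ linSpan (nullGens U) := by
      refine IsOrth.mem_linSpan fun u hu => ?_
      rw [dotProduct_comm]; exact hU u hu w hw
    have hzero : excess w ⬝ᵥ (β - t • α) = 0 := by
      generalize β - t • α = δ at hdiff
      induction hdiff using Submodule.span_induction with
      | mem x hx =>
        obtain ⟨g, hg, rfl⟩ := hx
        rw [dotProduct_comm]
        exact isOrth_of_mem_linSpan h1 hwU g hg
      | zero => simp
      | add x y _ _ hx hy => rw [dotProduct_add, hx, hy, add_zero]
      | smul t x _ hx => rw [dotProduct_smul, hx, smul_zero]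
    rw [dotProduct_sub, dotProduct_smul, hX.perp w hw, smul_zero, sub_zero] at hzero
    exact hzero

/-- Induction from the end of the list, since children are looked up only among later nodes. A
position out of range would merely drop a child, which makes the check harder to pass. -/
theorem settled_of_nodesOk {nodes : List Node} (h : nodesOk classes nodes = true) :
    ∀ n ∈ nodes, Settled classes n.vectors := by
  induction nodes with
  | nil => simp
  | cons n rest ih =>
    rw [nodesOk, Bool.and_eq_true] at h
    have ihr := ih h.2
    refine List.forall_mem_cons.2 ⟨fun X α hX hV => ?_, ihr⟩
    have h1 := h.1
    simp only [nodeOk, forceList_eq, forceLists_eq, Bool.and_eq_true] at h1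
    rcases testsOk_spec (classes := classes) h1.1 hX (hX.mem_region (hV α hX.perp)) (by simp)
      (fun β hβ => (hV β hβ).mem_linSpan) (fun V hm => by
        obtain ⟨i, _, hi⟩ := List.mem_filterMap.1 hm
        obtain ⟨m, hmi, rfl⟩ := Option.map_eq_some_iff.1 hi
        exact ihr m (List.mem_of_getElem? hmi)) with h2 | h2
    · exact endOk_spec h1.2 hX h2 hV
    · exact h2

/-! ### The certificate -/

def nodes₁ : List Node := [
   -- The root knows no element. Its test has coordinate sum 4, which is not divisible by 3, so 𝒳
   -- cannot be orthogonal to it and one of the children must occur.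
   ⟨[], [⟨1, 1, 1, 1, 0⟩], [0, 6, 20, 39, 66, 81, 102, 136, 186, 216, 254, 285, 313], none⟩,
   ⟨[20002], [⟨2, 1, 1, -2, -2⟩, ⟨1, 1, 1, -2, -1⟩, ⟨1, 1, 0, -1, -1⟩], [0, 1, 2, 3, 66, 85, 107, 200, 221, 257, 291, 316], some (1, 30124)⟩,
   ⟨[00210, 20002], [⟨1, 0, 0, 0, -1⟩, ⟨2, 1, 1, -2, -2⟩], [3, 157, 233, 258, 306, 323], some (7, 02431)⟩,
   ⟨[01020, 20002], [⟨1, 2, -1, -1, -1⟩, ⟨2, 2, -1, -1, -2⟩], [2, 110, 276, 293, 317], some (7, 03241)⟩,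
   ⟨[00120, 20002], [⟨1, 0, 0, 0, -1⟩, ⟨2, -1, 2, -1, -2⟩], [1, 137, 239, 263, 301, 333], some (7, 02341)⟩,
   ⟨[00030, 20002], [⟨1, 1, 1, 2, 1⟩], [0, 44, 104, 137, 247, 344], none⟩,
   ⟨[00300, 00030, 20002], [⟨1, 0, 0, 0, -1⟩], [346], some (29, 02341)⟩,
   ⟨[10011], [⟨3, 1, -1, 0, -3⟩, ⟨1, 1, -1, 0, -1⟩, ⟨3, 1, -1, 1, -4⟩], [0, 5, 7, 8, 9, 12, 14, 75, 99, 137, 184], some (1, 03412)⟩,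
   ⟨[10300, 10011], [⟨2, 1, 2, 2, 2⟩], [0, 1, 3, 185], none⟩,
   ⟨[05000, 10300, 10011], [⟨2, 1, 1, 1, 1⟩], [], none⟩,
   ⟨[01020, 10300, 10011], [⟨1, 1, 1, 2, 1⟩], [0, 237], none⟩,
   ⟨[00201, 01020, 10300, 10011], [⟨1, 0, 1, 1, 0⟩], [], none⟩,
   ⟨[01002, 10300, 10011], [⟨0, 0, 0, -1, 1⟩], [235], none⟩,
   ⟨[00400, 10011], [⟨1, 0, 0, 0, -1⟩, ⟨3, 0, 0, 1, -4⟩], [0, 9, 180], some (5, 03412)⟩,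
   ⟨[00102, 00400, 10011], [⟨0, 0, 0, -1, 1⟩], [233], none⟩,
   ⟨[00300, 10011], [⟨2, 0, 0, 1, -3⟩, ⟨4, 0, 0, -1, -3⟩], [10, 82, 92], some (3, 03412)⟩,
   ⟨[00210, 10011], [⟨1, 0, 0, 0, -1⟩, ⟨2, 1, -1, 2, -4⟩], [69, 104, 135], some (8, 02431)⟩,
   ⟨[00120, 10011], [⟨1, 1, 1, 2, 1⟩], [0, 107, 227], none⟩,
   ⟨[00201, 00120, 10011], [⟨1, 0, 1, 1, 0⟩], [0], none⟩,
   ⟨[01011, 00201, 00120, 10011], [⟨-1, -1, -1, -1, -2⟩], [], none⟩,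
   ⟨[00102, 10011], [⟨0, 0, 0, -1, 1⟩], [206, 224], none⟩,
   ⟨[10002], [⟨1, 1, 1, 1, 2⟩], [0, 2, 3, 9, 12, 15], none⟩,
   ⟨[10020, 10002], [⟨4, 1, -1, -2, -2⟩, ⟨2, 1, -1, -1, -1⟩], [0, 3, 89, 129, 222], some (7, 30124)⟩,
   ⟨[00400, 10020, 10002], [⟨2, 0, 0, -1, -1⟩], [224], some (61, 13402)⟩,
   ⟨[01020, 10002], [⟨2, 2, -2, -1, -1⟩, ⟨4, 2, -3, -1, -2⟩], [2, 7, 11, 48, 87, 124, 179, 203], some (11, 13042)⟩,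
   ⟨[00300, 10002], [⟨2, 2, 2, -1, 1⟩], [0, 1, 12, 44, 73], none⟩,
   ⟨[10011, 00300, 10002], [⟨2, 0, 0, -1, -1⟩], [90], some (41, 13402)⟩,
   ⟨[01020, 00300, 10002], [⟨2, -2, 0, 1, -1⟩], [0, 1, 2, 26, 46, 89], some (47, 23410)⟩,
   ⟨[04000, 01020, 00300, 10002], [], [], some (172, 23410)⟩,
   ⟨[03010, 01020, 00300, 10002], [], [], some (195, 23410)⟩,
   ⟨[03001, 01020, 00300, 10002], [], [], some (219, 32401)⟩,
   ⟨[00210, 10002], [⟨4, 1, 3, -6, -2⟩, ⟨2, 0, 1, -2, -1⟩], [0, 6, 23, 39, 57, 87, 120], some (11, 10432)⟩,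
   ⟨[01020, 00210, 10002], [⟨6, -4, -1, 2, -3⟩], [0, 23, 42, 143], some (82, 12430)⟩,
   ⟨[03100, 01020, 00210, 10002], [], [], some (336, 12430)⟩,
   ⟨[00120, 10002], [⟨2, -2, 2, -1, -1⟩, ⟨2, -1, 0, 0, -1⟩], [0, 1, 3, 22, 42, 55, 88, 210], some (11, 10342)⟩,
   ⟨[03010, 00120, 10002], [⟨0, 0, -2, 0, -1⟩], [98], none⟩,
   ⟨[01020, 00120, 10002], [⟨6, -2, -2, 1, -3⟩], [125, 211], some (75, 12340)⟩,
   ⟨[00030, 10002], [⟨2, 2, -1, 2, 1⟩], [0, 1, 41, 53, 116, 167], none⟩,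
   ⟨[00120, 00030, 10002], [⟨2, -1, 0, 0, -1⟩], [20, 61, 95], some (32, 10342)⟩,
   ⟨[00102, 00030, 10002], [⟨0, 0, 0, 2, 1⟩], [], none⟩,
   ⟨[02001], [⟨1, 1, 0, 0, -2⟩, ⟨2, 1, 1, -2, -2⟩, ⟨1, 2, 1, 1, 1⟩], [0, 1, 2, 6, 7, 10, 19, 22, 25, 118, 165, 224], none⟩,
   ⟨[00210, 02001], [⟨1, 1, 0, 0, -2⟩, ⟨2, 1, 1, -2, -2⟩], [2, 13, 20, 118, 225, 270, 282], some (11, 02431)⟩,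
   ⟨[00120, 02001], [⟨1, 1, 0, 0, -2⟩, ⟨2, 1, -2, 1, -2⟩], [1, 14, 22, 118, 203, 225, 292], some (11, 02341)⟩,
   ⟨[00030, 02001], [⟨1, 1, 0, 0, -2⟩, ⟨2, 2, 0, 1, -2⟩], [0, 1, 2, 6, 14, 119, 303], none⟩,
   ⟨[00210, 00030, 02001], [⟨1, 1, 0, 0, -2⟩], [14, 308], some (32, 02341)⟩,
   ⟨[00111, 00030, 02001], [⟨0, -1, -2, 0, 0⟩], [307], none⟩,
   ⟨[00102, 00030, 02001], [⟨0, -1, -2, 0, 0⟩], [306], none⟩,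
   ⟨[30002, 02001], [⟨1, 2, 2, 2, 2⟩], [], none⟩,
   ⟨[20002, 02001], [⟨1, 2, 1, 1, 1⟩], [0, 1, 12, 15, 111, 219, 295], none⟩,
   ⟨[00300, 20002, 02001], [⟨2, 1, 1, -2, -2⟩], [303], none⟩,
   ⟨[00030, 20002, 02001], [⟨1, 1, 0, 1, 0⟩], [302], none⟩,
   ⟨[10002, 02001], [⟨1, 1, 1, 1, 2⟩], [0, 1, 3, 5, 6], none⟩,
   ⟨[01020, 10002, 02001], [⟨2, 2, -1, 0, 0⟩], [1, 3, 109], none⟩,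
   ⟨[00300, 10002, 02001], [⟨2, 1, 0, -2, -1⟩], [0, 5], none⟩,
   ⟨[01020, 00300, 10002, 02001], [], [], some (213, 32401)⟩,
   ⟨[00210, 10002, 02001], [⟨4, 1, 3, -6, -2⟩], [0, 3], some (82, 24013)⟩,
   ⟨[01020, 00210, 10002, 02001], [], [], some (324, 41023)⟩,
   ⟨[00120, 10002, 02001], [⟨4, 1, -6, 3, -2⟩], [1, 104], some (82, 24103)⟩,
   ⟨[00030, 10002, 02001], [⟨2, 1, -2, 0, -1⟩], [0, 105], none⟩,
   ⟨[00120, 00030, 10002, 02001], [], [], some (127, 20341)⟩]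

def nodes₂ : List Node := [
   ⟨[00102, 02001], [⟨1, 0, -2, 0, 1⟩], [0, 1, 185, 221, 269], none⟩,
   ⟨[01110, 00102, 02001], [⟨0, 0, 0, -2, -1⟩], [291], none⟩,
   ⟨[00210, 00102, 02001], [⟨0, -1, 0, -2, 0⟩], [290], none⟩,
   ⟨[00012, 02001], [⟨1, 0, 0, -2, 1⟩], [0, 1, 228, 248, 283], none⟩,
   ⟨[01110, 00012, 02001], [⟨0, 0, -2, 0, -1⟩], [288], none⟩,
   ⟨[00120, 00012, 02001], [⟨0, -1, -2, 0, 0⟩], [287], none⟩,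
   ⟨[00003, 02001], [⟨1, 1, 0, 0, 1⟩], [257, 263, 268, 277, 280], none⟩,
   ⟨[01101], [⟨2, 1, 1, -2, -2⟩, ⟨1, 1, 1, -1, -2⟩, ⟨1, 1, 0, -1, -1⟩], [0, 1, 4, 8, 10, 12, 26, 36, 91, 140, 150, 195, 222], some (1, 30142)⟩,
   ⟨[20002, 01101], [⟨2, 1, 1, -2, -2⟩, ⟨1, 1, 0, -1, -1⟩], [45, 91, 175, 281], some (19, 40123)⟩,
   ⟨[10002, 01101], [⟨1, 1, 1, 1, 2⟩], [0, 1, 3, 7, 9], none⟩,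
   ⟨[00300, 10002, 01101], [⟨2, 1, 1, -1, 0⟩], [3, 29], none⟩,
   ⟨[00210, 10002, 01101], [⟨2, 0, 1, -2, -1⟩], [3, 28], some (65, 04312)⟩,
   ⟨[01020, 01101], [⟨1, 2, 2, -1, -4⟩, ⟨1, 2, 0, -1, -2⟩], [0, 41, 88, 136, 212, 225, 249], some (8, 23041)⟩,
   ⟨[10002, 01020, 01101], [⟨2, 4, -3, -2, -1⟩], [0, 1, 88], some (85, 31204)⟩,
   ⟨[00300, 10002, 01020, 01101], [], [], some (145, 13402)⟩,
   ⟨[00210, 10002, 01020, 01101], [], [], some (266, 24130)⟩,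
   ⟨[00120, 01101], [⟨0, 1, 0, 0, -1⟩, ⟨1, 0, 2, -1, -2⟩], [0, 20, 84, 167, 197, 230, 262], some (8, 20341)⟩,
   ⟨[10002, 00120, 01101], [⟨2, -3, 4, -2, -1⟩], [22, 84], some (85, 32104)⟩,
   ⟨[00030, 01101], [⟨0, 1, 1, 0, -2⟩, ⟨0, 1, 0, 0, -1⟩], [0, 18, 51, 84, 130, 175, 271], some (3, 30142)⟩,
   ⟨[10002, 00030, 01101], [⟨0, 0, -1, 0, 1⟩], [20, 84], none⟩,
   ⟨[00003, 01101], [⟨0, -1, -1, -1, 0⟩], [0, 241, 244, 249, 258, 269], none⟩,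
   ⟨[02010, 00003, 01101], [⟨1, 1, 0, 0, 1⟩], [271], none⟩,
   ⟨[01011], [⟨1, 1, -1, 2, -3⟩, ⟨1, 1, -1, 0, -1⟩, ⟨2, 1, -2, 0, -1⟩], [0, 2, 4, 5, 9, 10, 11, 12, 13, 18, 28, 82, 110, 147, 182, 216], some (1, 30412)⟩,
   ⟨[02200, 01011], [⟨1, 1, -1, 2, -3⟩, ⟨1, 1, -1, 0, -1⟩], [0, 2, 14, 28, 83, 110], some (19, 23401)⟩,
   ⟨[00102, 02200, 01011], [⟨0, 0, 0, -1, 1⟩], [163], none⟩,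
   ⟨[00210, 01011], [⟨1, 1, -1, 2, -3⟩, ⟨0, 1, 0, 0, -1⟩], [0, 3, 11, 89, 152, 181, 223, 242], some (8, 20431)⟩,
   ⟨[10011, 00210, 01011], [⟨1, 1, -1, 2, -3⟩], [89], some (95, 12430)⟩,
   ⟨[20002, 01011], [⟨2, 1, -2, 1, -2⟩, ⟨1, 1, -1, 0, -1⟩], [26, 180, 221, 245], some (19, 40213)⟩,
   ⟨[10002, 01011], [⟨1, 1, 1, 1, 2⟩], [0, 1, 2, 10, 23], none⟩,
   ⟨[00210, 10002, 01011], [⟨-2, 3, 2, -4, 1⟩], [10, 86], some (85, 32014)⟩,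
   ⟨[00120, 10002, 01011], [⟨2, 0, -2, 1, -1⟩], [9, 78, 157], some (65, 04132)⟩,
   ⟨[00030, 10002, 01011], [⟨0, -1, -1, 0, -1⟩], [8, 78], none⟩,
   ⟨[01300, 01011], [⟨0, 0, 1, 1, 1⟩], [101], none⟩,
   ⟨[01200, 01011], [⟨1, 2, -1, 2, -4⟩, ⟨1, 2, -1, 0, -2⟩], [20, 101, 139, 173, 208, 223], some (8, 23401)⟩,
   ⟨[01101, 01011], [⟨1, 1, -1, -1, 0⟩, ⟨2, 1, -2, -2, 1⟩], [2, 19, 181, 206], some (19, 40231)⟩,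
   ⟨[00400, 01011], [⟨0, -2, 0, 1, 1⟩, ⟨0, 0, 0, 1, -1⟩], [19, 98], some (5, 30412)⟩,
   ⟨[00300, 01011], [⟨0, 1, 0, 0, -1⟩, ⟨0, 0, 0, 1, -1⟩], [0, 1, 2, 19, 98, 169, 203, 236], some (3, 30412)⟩,
   ⟨[01101, 00300, 01011], [⟨0, 1, 0, 0, -1⟩], [2, 255], some (30, 20341)⟩,
   ⟨[10011, 00300, 01011], [⟨0, 0, 0, 1, -1⟩], [18], some (37, 23401)⟩,
   ⟨[10002, 00300, 01011], [⟨0, 1, 0, -2, 1⟩], [0, 17], none⟩,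
   ⟨[00030, 10002, 00300, 01011], [], [], some (123, 20341)⟩,
   ⟨[00003, 01011], [⟨0, -1, -1, -1, 0⟩], [0, 215, 226, 231, 234, 245], none⟩,
   ⟨[02100, 00003, 01011], [⟨1, 1, 0, 0, 1⟩], [250], none⟩,
   ⟨[01002], [⟨1, 1, 0, -2, 0⟩], [0, 1, 3, 5, 7, 14, 18, 24, 32, 106, 165], none⟩,
   ⟨[20020, 01002], [⟨1, 2, -1, -1, -1⟩, ⟨2, 2, -1, -2, -1⟩], [9, 25, 169, 208, 225], some (7, 03214)⟩,
   ⟨[10020, 01002], [⟨2, 2, -2, -1, -1⟩, ⟨2, 4, -3, -1, -2⟩], [0, 6, 14, 20, 66, 105, 114], some (11, 13024)⟩,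
   ⟨[00300, 10020, 01002], [⟨2, -2, 0, -1, 1⟩], [10], some (47, 23401)⟩,
   ⟨[10011, 01002], [⟨1, 1, 1, 1, 2⟩], [0, 4, 13, 17], none⟩,
   ⟨[00300, 10011, 01002], [⟨0, 0, 0, -1, 1⟩], [8], none⟩,
   ⟨[01110, 01002], [⟨1, 2, 2, -4, -1⟩, ⟨1, 2, 0, -2, -1⟩], [0, 4, 126, 161, 196, 234], some (8, 23014)⟩,
   ⟨[00030, 01110, 01002], [⟨0, 0, -2, 0, -1⟩], [242], none⟩,
   ⟨[01011, 01002], [⟨2, 2, -2, -1, -1⟩, ⟨1, 2, -1, -1, -1⟩], [0, 1, 2, 3, 4, 63, 135, 235], some (7, 03124)⟩,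
   ⟨[10002, 01011, 01002], [⟨2, 2, -2, -1, -1⟩], [4, 63, 135], some (73, 23014)⟩,
   ⟨[01300, 01011, 01002], [⟨0, 2, 0, -1, -1⟩], [134], none⟩,
   ⟨[01101, 01011, 01002], [⟨1, 2, -1, -1, -1⟩], [238], some (80, 03124)⟩,
   ⟨[00400, 01011, 01002], [⟨0, 2, 0, -1, -1⟩], [132], some (61, 31402)⟩,
   ⟨[00300, 01011, 01002], [⟨0, 2, 0, -1, -1⟩], [0, 236], some (41, 31402)⟩,
   ⟨[10002, 00300, 01011, 01002], [], [], some (139, 23401)⟩,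
   ⟨[00210, 01002], [⟨2, 2, 3, -6, -1⟩, ⟨1, 0, 1, -2, 0⟩], [0, 1, 2, 12, 56, 117, 154, 194, 205], some (11, 01432)⟩,
   ⟨[03010, 00210, 01002], [⟨2, 2, 3, -6, -1⟩], [14, 56], some (75, 23014)⟩]

def nodes₃ : List Node := [
   ⟨[10020, 00210, 01002], [⟨-4, 6, -1, 2, -3⟩], [55], some (82, 21430)⟩,
   ⟨[10011, 00210, 01002], [⟨3, -2, 2, -4, 1⟩], [54], some (85, 23014)⟩,
   ⟨[00120, 01002], [⟨2, 2, -6, 3, -1⟩, ⟨1, 0, -2, 1, 0⟩], [0, 1, 2, 3, 4, 8, 54, 124, 151, 183, 212], some (11, 01342)⟩,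
   ⟨[03100, 00120, 01002], [⟨2, 2, -6, 3, -1⟩], [10, 56, 124], some (75, 23104)⟩,
   ⟨[10300, 00120, 01002], [⟨-1, 0, 0, -1, -1⟩], [123], none⟩,
   ⟨[02200, 00120, 01002], [⟨0, 2, -2, 1, -1⟩], [122], some (65, 40132)⟩,
   ⟨[01300, 00120, 01002], [⟨2, -6, 2, -1, 3⟩], [121], some (75, 21340)⟩,
   ⟨[00400, 00120, 01002], [⟨-1, 0, 0, -1, -1⟩], [120], none⟩,
   ⟨[00030, 01002], [⟨0, 0, -2, 0, -1⟩], [0, 1, 2, 6, 52, 86, 218], none⟩,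
   ⟨[20101, 00030, 01002], [⟨1, 0, -1, 0, 0⟩], [223], none⟩,
   ⟨[01101, 00030, 01002], [⟨0, -2, 1, 0, 1⟩], [222], some (41, 31042)⟩,
   ⟨[00210, 00030, 01002], [⟨-1, 2, 0, 0, -1⟩], [0, 1, 2, 221], some (32, 01342)⟩,
   ⟨[50000, 00210, 00030, 01002], [], [], some (133, 21340)⟩,
   ⟨[30001, 00210, 00030, 01002], [], [], some (131, 02341)⟩,
   ⟨[10002, 00210, 00030, 01002], [], [], some (125, 12340)⟩,
   ⟨[00102, 00030, 01002], [⟨1, 0, 0, 1, 1⟩], [217], none⟩,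
   ⟨[00012, 01002], [⟨0, -1, 0, -2, 0⟩], [169, 176, 210], none⟩,
   ⟨[00201], [⟨1, 0, 1, 0, -2⟩, ⟨1, 1, 2, 1, -1⟩], [0, 1, 3, 6, 7, 10, 18, 21, 27, 33, 46, 137, 191], none⟩,
   ⟨[21001, 00201], [⟨1, 0, 1, 0, -2⟩, ⟨0, 2, 1, -1, -2⟩], [1, 7, 10, 18, 22, 36, 47, 141, 193], some (11, 01423)⟩,
   ⟨[20011, 00201], [⟨1, 0, 1, 0, -2⟩, ⟨2, 1, 1, -2, -2⟩], [0, 20, 33, 139, 162, 191], some (11, 02413)⟩,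
   ⟨[00030, 20011, 00201], [⟨1, 0, 1, 0, -2⟩], [212], some (32, 03241)⟩,
   ⟨[20002, 00201], [⟨1, 2, 2, 0, 1⟩], [0, 1, 18, 43, 138, 191], none⟩,
   ⟨[00120, 20002, 00201], [⟨1, 0, 2, 0, 0⟩], [210], none⟩,
   ⟨[00030, 20002, 00201], [⟨1, 0, 1, 1, 0⟩], [209], none⟩,
   ⟨[12001, 00201], [⟨2, 2, 3, -1, -6⟩, ⟨2, 0, 1, -1, -2⟩], [7, 12, 21, 27], some (11, 10423)⟩,
   ⟨[10011, 00201], [⟨3, -2, 2, 1, -4⟩, ⟨1, 0, 0, -1, 0⟩], [0, 1, 6, 21], some (8, 02413)⟩,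
   ⟨[01020, 10011, 00201], [⟨3, -2, 2, 1, -4⟩], [29], some (85, 23041)⟩,
   ⟨[01002, 10011, 00201], [⟨0, 0, -1, -2, 0⟩], [28], none⟩,
   ⟨[10002, 00201], [⟨1, 1, 1, 1, 2⟩], [0, 3, 4, 5], none⟩,
   ⟨[01020, 10002, 00201], [⟨4, -6, 1, 3, -2⟩], [0, 1, 12, 26], some (82, 21403)⟩,
   ⟨[04000, 01020, 10002, 00201], [], [], some (272, 24031)⟩,
   ⟨[03100, 01020, 10002, 00201], [], [], some (338, 21403)⟩,
   ⟨[00210, 10002, 00201], [⟨4, -1, 1, -2, -2⟩], [23], some (74, 10423)⟩,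
   ⟨[00120, 10002, 00201], [⟨2, -1, 2, 0, 0⟩], [8, 15, 26], none⟩,
   ⟨[00030, 10002, 00201], [⟨-1, -2, -2, -2, -2⟩], [0, 15], none⟩,
   ⟨[04000, 00030, 10002, 00201], [], [], some (152, 30142)⟩,
   ⟨[03001, 00201], [⟨1, 1, 1, 1, 2⟩], [0, 1], none⟩,
   ⟨[01020, 03001, 00201], [⟨2, 2, 3, -1, -6⟩], [18], some (75, 23041)⟩,
   ⟨[00210, 03001, 00201], [⟨1, 1, 2, 1, 1⟩], [17], none⟩,
   ⟨[01101, 00201], [⟨1, 0, 0, -1, 0⟩, ⟨1, 1, 1, -1, -2⟩], [0, 1, 3, 116, 132, 170], some (7, 02413)⟩,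
   ⟨[00210, 01101, 00201], [⟨2, 1, 1, -2, -2⟩], [192], some (73, 01423)⟩,
   ⟨[00120, 01101, 00201], [⟨1, 2, 2, -1, -4⟩], [0, 191], some (74, 02341)⟩,
   ⟨[10002, 00120, 01101, 00201], [], [], some (318, 41203)⟩,
   ⟨[00030, 01101, 00201], [⟨0, 1, 1, 0, -2⟩], [0, 189], some (41, 30241)⟩,
   ⟨[10002, 00030, 01101, 00201], [⟨-1, -2, -2, -2, -2⟩], [], none⟩,
   ⟨[01011, 00201], [⟨-2, 3, 2, 1, -4⟩, ⟨0, 1, 0, -1, 0⟩], [0, 1, 2, 9, 110, 136, 167], some (8, 20413)⟩,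
   ⟨[10020, 01011, 00201], [⟨-2, 3, 2, 1, -4⟩], [9], some (85, 32041)⟩,
   ⟨[10011, 01011, 00201], [⟨-1, -1, 1, 3, -2⟩], [8], some (95, 12403)⟩,
   ⟨[10002, 01011, 00201], [⟨1, 1, 1, 1, 2⟩], [0, 1, 7], none⟩,
   ⟨[00120, 10002, 01011, 00201], [], [], some (292, 34210)⟩,
   ⟨[00030, 10002, 01011, 00201], [], [], some (198, 32041)⟩,
   ⟨[01002, 00201], [⟨1, 1, 1, 1, 2⟩], [0, 1, 2, 3, 5, 9, 158], none⟩,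
   ⟨[10020, 01002, 00201], [⟨6, -4, -1, -3, 2⟩], [3], some (82, 12403)⟩,
   ⟨[02010, 01002, 00201], [⟨0, 0, -1, -2, 0⟩], [179], none⟩,
   ⟨[01110, 01002, 00201], [⟨0, 0, 0, -2, -1⟩], [178], none⟩,
   ⟨[00210, 01002, 00201], [⟨-1, 4, 1, -2, -2⟩], [0, 177], some (74, 01423)⟩,
   ⟨[10002, 00210, 01002, 00201], [], [], some (314, 14023)⟩,
   ⟨[00120, 01002, 00201], [⟨1, 0, 2, 1, 2⟩], [0, 1, 2, 175], none⟩,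
   ⟨[13000, 00120, 01002, 00201], [], [], some (340, 01342)⟩,
   ⟨[04000, 00120, 01002, 00201], [], [], some (270, 04213)⟩]

def nodes₄ : List Node := [
   ⟨[03100, 00120, 01002, 00201], [⟨0, 0, 2, 0, 1⟩], [], none⟩,
   ⟨[00030, 01002, 00201], [⟨0, -2, -1, 0, 0⟩], [0, 1, 171], none⟩,
   ⟨[13000, 00030, 01002, 00201], [], [], some (154, 32041)⟩,
   ⟨[04000, 00030, 01002, 00201], [], [], some (176, 03142)⟩,
   ⟨[00012, 00201], [⟨1, 0, 0, -2, 1⟩], [0, 1, 107, 117, 166], none⟩,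
   ⟨[01110, 00012, 00201], [⟨0, -2, 0, 0, -1⟩], [167], none⟩,
   ⟨[01020, 00012, 00201], [⟨0, -2, -1, 0, 0⟩], [166], none⟩,
   ⟨[00111], [⟨0, 0, 0, 1, -1⟩, ⟨0, 0, 1, 0, -1⟩, ⟨1, -1, 0, 0, 0⟩], [0, 2, 3, 4, 5, 8, 12, 13, 14, 15, 18, 20, 22, 51, 87, 120, 152], some (1, 34012)⟩,
   ⟨[04000, 00111], [⟨0, 0, -2, 1, 1⟩, ⟨0, 0, 0, 1, -1⟩], [0, 5, 51, 88, 121], some (5, 34012)⟩,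
   ⟨[00300, 04000, 00111], [⟨0, 0, 2, -1, -1⟩], [162], none⟩,
   ⟨[03000, 00111], [⟨0, 0, 0, -1, 1⟩, ⟨0, 0, 1, -1, 0⟩], [4, 18, 50, 87, 120, 153], some (3, 34012)⟩,
   ⟨[20011, 00111], [⟨-1, 1, -2, 1, 1⟩, ⟨0, 0, 0, -1, 1⟩], [3, 52, 87, 120], some (8, 24301)⟩,
   ⟨[10011, 00111], [⟨-2, 2, -2, 1, 1⟩, ⟨0, 0, 0, 1, -1⟩], [1, 52], some (19, 24301)⟩,
   ⟨[01011, 00111], [⟨1, -1, -1, 1, 0⟩, ⟨0, 0, 0, -1, 1⟩], [0, 1, 53, 82, 115], some (19, 42301)⟩,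
   ⟨[00400, 01011, 00111], [⟨0, 0, 0, 1, -1⟩], [53], some (59, 23401)⟩,
   ⟨[00300, 01011, 00111], [⟨0, 0, 0, -1, 1⟩], [157], some (30, 23401)⟩,
   ⟨[40001, 00111], [⟨0, -1, -1, 0, -1⟩], [0, 1, 2, 45, 82, 147], none⟩,
   ⟨[01200, 40001, 00111], [⟨1, 0, 2, 0, 0⟩], [155], none⟩,
   ⟨[01101, 40001, 00111], [⟨1, 0, 2, 0, 0⟩], [154], none⟩,
   ⟨[00300, 40001, 00111], [⟨1, 0, 2, 0, 0⟩], [153], none⟩,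
   ⟨[30001, 00111], [⟨-1, -2, -2, -2, -2⟩], [], none⟩,
   ⟨[20101, 00111], [⟨-1, 1, 1, -2, 1⟩, ⟨0, 0, -1, 0, 1⟩], [7, 44, 77, 107], some (8, 24031)⟩,
   ⟨[20002, 00111], [⟨2, -2, 1, 1, -2⟩, ⟨0, 0, 1, -1, 0⟩], [41, 77, 106, 141], some (19, 42013)⟩,
   ⟨[10002, 00111], [⟨1, 1, 1, 1, 2⟩], [0, 1, 41], none⟩,
   ⟨[01020, 10002, 00111], [⟨2, -2, 0, 1, -1⟩], [43], some (65, 01432)⟩,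
   ⟨[00030, 10002, 00111], [⟨0, -1, -1, 0, -1⟩], [10], none⟩,
   ⟨[02001, 00111], [⟨-1, 1, 1, 1, -2⟩, ⟨0, 0, 1, -1, 0⟩], [0, 39, 69, 105, 137], some (8, 24013)⟩,
   ⟨[10002, 02001, 00111], [⟨0, -1, -1, -1, 0⟩], [], none⟩,
   ⟨[01101, 00111], [⟨1, -1, 1, -1, 0⟩, ⟨0, 0, -1, 0, 1⟩], [0, 35, 67, 104], some (19, 42031)⟩,
   ⟨[00030, 01101, 00111], [⟨0, 0, -1, 0, 1⟩], [143], some (30, 23041)⟩,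
   ⟨[01002, 00111], [⟨1, 1, 1, 1, 2⟩], [0, 1, 2, 3, 4, 36, 102, 133], none⟩,
   ⟨[10020, 01002, 00111], [⟨2, -2, 0, -1, 1⟩], [36], some (65, 01423)⟩,
   ⟨[02100, 01002, 00111], [⟨0, -1, 0, -2, 0⟩], [140], none⟩,
   ⟨[02010, 01002, 00111], [⟨0, -1, -2, 0, 0⟩], [139], none⟩,
   ⟨[00300, 01002, 00111], [⟨1, 0, 1, 0, 1⟩], [138], none⟩,
   ⟨[00030, 01002, 00111], [⟨1, 0, 0, 1, 1⟩], [0, 137], none⟩,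
   ⟨[04000, 00030, 01002, 00111], [⟨0, 0, -1, 1, 0⟩], [], none⟩,
   ⟨[00102], [⟨1, 0, 0, -2, 1⟩], [0, 1, 3, 5, 6, 12, 16, 21, 31, 63], none⟩,
   ⟨[20020, 00102], [⟨1, -1, 2, -1, -1⟩, ⟨1, 0, 0, -1, 0⟩], [25, 35, 66, 82, 111], some (7, 02314)⟩,
   ⟨[10020, 00102], [⟨2, -2, 2, -1, -1⟩, ⟨2, -1, 0, -1, 0⟩], [0, 5, 11, 25], some (11, 10324)⟩,
   ⟨[01002, 10020, 00102], [⟨-6, 2, 2, 3, -1⟩], [27], some (75, 12304)⟩,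
   ⟨[02010, 00102], [⟨1, 1, 0, -2, 0⟩, ⟨1, 0, -2, 0, 1⟩], [0, 14, 24, 28, 79, 109], some (11, 02314)⟩,
   ⟨[00021, 02010, 00102], [⟨0, -1, -2, 0, 0⟩], [130], none⟩,
   ⟨[01110, 00102], [⟨-1, 1, -2, 1, 1⟩, ⟨0, 1, 0, -1, 0⟩], [12, 20, 73, 109], some (8, 20314)⟩,
   ⟨[01020, 00102], [⟨2, 2, -6, -1, 3⟩, ⟨1, -2, 0, 1, 0⟩], [0, 1, 2, 3, 4, 12, 22, 25, 60, 72, 107], some (11, 01324)⟩,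
   ⟨[03100, 01020, 00102], [⟨2, 2, -6, -1, 3⟩], [22], some (75, 23140)⟩,
   ⟨[10300, 01020, 00102], [⟨-1, 0, 0, -1, -1⟩], [21], none⟩,
   ⟨[02200, 01020, 00102], [⟨0, 2, -2, -1, 1⟩], [20], some (65, 40123)⟩,
   ⟨[01300, 01020, 00102], [⟨2, -6, 2, 3, -1⟩], [19], some (75, 21304)⟩,
   ⟨[00400, 01020, 00102], [⟨-1, 0, 0, -1, -1⟩], [18], none⟩,
   ⟨[01011, 00102], [⟨1, 1, 1, 1, 2⟩], [0, 1, 2, 7, 16, 20, 70, 102], none⟩,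
   ⟨[10020, 01011, 00102], [⟨2, 0, -2, -1, 1⟩], [16], some (65, 04123)⟩,
   ⟨[03000, 01011, 00102], [⟨1, 1, 0, 0, 1⟩], [120], none⟩,
   ⟨[01200, 01011, 00102], [⟨0, 0, -1, -2, 0⟩], [119], none⟩,
   ⟨[00210, 00102], [⟨1, 0, 1, -2, 0⟩], [0, 1, 2, 3, 116], none⟩,
   ⟨[20020, 00210, 00102], [⟨1, 0, 2, 0, 0⟩], [117], none⟩,
   ⟨[01110, 00210, 00102], [⟨1, 2, 2, -4, -1⟩], [116], some (74, 02314)⟩,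
   ⟨[01020, 00210, 00102], [⟨0, -2, 0, 0, -1⟩], [115], none⟩,
   ⟨[01011, 00210, 00102], [⟨0, -2, -1, 0, 0⟩], [114], none⟩,
   ⟨[00111, 00102], [⟨0, 0, 2, -1, -1⟩, ⟨1, -1, 0, 0, 0⟩], [0, 1, 2, 3, 4, 5, 6, 7, 111], some (7, 01324)⟩]

def nodes₅ : List Node := [
   ⟨[04000, 00111, 00102], [⟨0, 0, 2, -1, -1⟩], [7, 111], some (61, 34102)⟩,
   ⟨[03000, 00111, 00102], [⟨0, 0, -2, 1, 1⟩], [111], some (41, 34102)⟩,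
   ⟨[40001, 00111, 00102], [⟨1, 0, 2, 0, 0⟩], [110], none⟩,
   ⟨[30001, 00111, 00102], [⟨-1, -2, -2, -2, -2⟩], [], none⟩,
   ⟨[20002, 00111, 00102], [⟨1, -1, 2, -1, -1⟩], [108], some (80, 01324)⟩,
   ⟨[10002, 00111, 00102], [⟨2, -2, 2, -1, -1⟩], [2], some (73, 20314)⟩,
   ⟨[02001, 00111, 00102], [⟨1, -1, -4, 2, 2⟩], [106], some (74, 04123)⟩,
   ⟨[01002, 00111, 00102], [⟨2, -2, -2, 1, 1⟩], [0, 105], some (73, 02314)⟩,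
   ⟨[00400, 01002, 00111, 00102], [], [], some (264, 23401)⟩,
   ⟨[00030, 00102], [⟨1, 0, -2, 0, 1⟩, ⟨1, 1, 0, 2, 2⟩], [0, 1, 2, 3, 4, 101], none⟩,
   ⟨[03000, 00030, 00102], [⟨1, 0, -2, 0, 1⟩], [102], some (32, 03142)⟩,
   ⟨[20200, 00030, 00102], [⟨1, 0, 0, 1, 1⟩], [101], none⟩,
   ⟨[01200, 00030, 00102], [⟨0, -2, 0, 0, -1⟩], [100], none⟩,
   ⟨[01110, 00030, 00102], [⟨0, -2, 0, 0, -1⟩], [99], none⟩,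
   ⟨[01101, 00030, 00102], [⟨0, 1, -2, 0, 1⟩], [98], some (41, 30142)⟩,
   ⟨[00021], [⟨1, 0, 0, 1, -2⟩, ⟨0, 0, 0, 1, -1⟩], [0, 1, 3, 6, 7, 9, 13, 19, 25, 90], none⟩,
   ⟨[21001, 00021], [⟨1, 0, 0, 1, -2⟩, ⟨1, -2, 1, 0, 0⟩], [1, 10, 17, 23, 26, 92], some (11, 01243)⟩,
   ⟨[20101, 00021], [⟨1, 0, 0, 1, -2⟩, ⟨1, 1, -2, 0, 0⟩], [0, 10, 12, 21, 27, 90], some (11, 02143)⟩,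
   ⟨[00300, 20101, 00021], [⟨1, 0, 0, 1, -2⟩], [94], some (32, 03421)⟩,
   ⟨[20002, 00021], [⟨0, -2, 0, 0, -1⟩], [0, 1, 8, 11, 20, 90], none⟩,
   ⟨[03000, 20002, 00021], [⟨1, 1, 0, 1, 0⟩], [92], none⟩,
   ⟨[02010, 20002, 00021], [⟨0, -1, -1, 0, -1⟩], [91], none⟩,
   ⟨[10002, 00021], [⟨1, 1, 1, 1, 2⟩], [], none⟩,
   ⟨[01101, 00021], [⟨-1, 1, 1, 1, -2⟩, ⟨0, -1, 1, 0, 0⟩], [0, 10, 12, 21, 86], some (8, 20143)⟩,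
   ⟨[10002, 01101, 00021], [⟨0, -1, -1, -1, 0⟩], [], none⟩,
   ⟨[01011, 00021], [⟨1, 0, -1, 0, 0⟩, ⟨0, 1, 0, 1, -2⟩], [0, 1, 2, 10, 16, 81], some (7, 02143)⟩,
   ⟨[00300, 01011, 00021], [⟨0, 1, 0, 1, -2⟩], [86], some (41, 30421)⟩,
   ⟨[00210, 01011, 00021], [⟨1, 2, -1, 2, -4⟩], [85], some (74, 02431)⟩,
   ⟨[00120, 01011, 00021], [⟨2, 1, -2, 1, -2⟩], [84], some (73, 01243)⟩,
   ⟨[01002, 00021], [⟨1, 1, 1, 1, 2⟩], [0, 1, 2, 3, 4, 77], none⟩,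
   ⟨[02100, 01002, 00021], [⟨0, 0, -2, -1, 0⟩], [82], none⟩,
   ⟨[01110, 01002, 00021], [⟨0, 0, -2, 0, -1⟩], [81], none⟩,
   ⟨[00300, 01002, 00021], [⟨0, -2, 0, -1, 0⟩], [80], none⟩,
   ⟨[00210, 01002, 00021], [⟨0, -2, -1, 0, 0⟩], [79], none⟩,
   ⟨[00120, 01002, 00021], [⟨1, -4, 2, -1, 2⟩], [78], some (74, 01243)⟩,
   ⟨[00111, 00021], [⟨1, -1, -1, -1, 2⟩, ⟨1, -1, 0, 0, 0⟩], [0, 1, 2, 3, 4, 75], some (7, 01243)⟩,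
   ⟨[01011, 00111, 00021], [⟨1, -1, -1, -1, 2⟩], [76], some (80, 01243)⟩,
   ⟨[04000, 00111, 00021], [⟨0, 0, -1, -1, 2⟩], [74], some (61, 34021)⟩,
   ⟨[03000, 00111, 00021], [⟨0, 0, 1, 1, -2⟩], [74], some (41, 34021)⟩,
   ⟨[02010, 00111, 00021], [⟨1, -1, 2, 2, -4⟩], [73], some (74, 04231)⟩,
   ⟨[01020, 00111, 00021], [⟨2, -2, 1, 1, -2⟩], [72], some (73, 02143)⟩,
   ⟨[00102, 00021], [⟨1, 0, -2, 0, 1⟩], [0, 1, 2, 3, 69], none⟩,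
   ⟨[20200, 00102, 00021], [⟨0, -1, -1, -1, 0⟩], [70], none⟩,
   ⟨[01200, 00102, 00021], [⟨0, -2, 0, -1, 0⟩], [69], none⟩,
   ⟨[01110, 00102, 00021], [⟨0, -2, 0, 0, -1⟩], [68], none⟩,
   ⟨[01101, 00102, 00021], [⟨1, 2, -4, -1, 2⟩], [67], some (74, 02143)⟩,
   ⟨[00012], [⟨1, 0, 0, -2, 1⟩, ⟨0, 0, 0, -1, 1⟩], [0, 1, 3, 6, 7, 12, 16, 21, 59], none⟩,
   ⟨[21010, 00012], [⟨1, 0, 0, -2, 1⟩, ⟨1, -2, 1, 0, 0⟩], [1, 9, 14, 17, 25, 61], some (11, 01234)⟩,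
   ⟨[20110, 00012], [⟨1, 0, 0, -2, 1⟩, ⟨1, 1, -2, 0, 0⟩], [0, 7, 12, 17, 23, 59], some (11, 02134)⟩,
   ⟨[00300, 20110, 00012], [⟨1, 0, 0, -2, 1⟩], [63], some (32, 03412)⟩,
   ⟨[20020, 00012], [⟨0, -2, 0, -1, 0⟩], [0, 1, 7, 10, 22, 59], none⟩,
   ⟨[03000, 20020, 00012], [⟨1, 1, 0, 0, 1⟩], [61], none⟩,
   ⟨[02001, 20020, 00012], [⟨0, -1, -1, -1, 0⟩], [60], none⟩,
   ⟨[01110, 00012], [⟨-1, 1, 1, -2, 1⟩, ⟨0, -1, 1, 0, 0⟩], [3, 12, 15, 56], some (8, 20134)⟩,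
   ⟨[01020, 00012], [⟨1, -2, 0, 1, 0⟩], [0, 1, 2, 3, 52], none⟩,
   ⟨[22000, 01020, 00012], [⟨0, -1, -1, 0, -1⟩], [57], none⟩,
   ⟨[02100, 01020, 00012], [⟨0, 0, -2, 0, -1⟩], [56], none⟩,
   ⟨[01110, 01020, 00012], [⟨1, -4, 2, 2, -1⟩], [55], some (74, 01234)⟩,
   ⟨[01101, 01020, 00012], [⟨0, 0, -2, -1, 0⟩], [54], none⟩,
   ⟨[01011, 00012], [⟨0, 1, 0, -2, 1⟩, ⟨1, 0, -1, 0, 0⟩], [0, 1, 2, 4, 9, 47], some (7, 02134)⟩]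

def nodes₆ : List Node := [
   ⟨[00300, 01011, 00012], [⟨0, 1, 0, -2, 1⟩], [52], some (41, 30412)⟩,
   ⟨[20020, 01011, 00012], [⟨2, 1, -2, -2, 1⟩], [51], some (73, 01234)⟩,
   ⟨[20011, 01011, 00012], [⟨1, 2, -1, -4, 2⟩], [50], some (74, 02413)⟩,
   ⟨[00120, 00012], [⟨1, 0, -2, 1, 0⟩], [0, 1, 2, 3, 47], none⟩,
   ⟨[20200, 00120, 00012], [⟨0, -1, -1, 0, -1⟩], [48], none⟩,
   ⟨[01200, 00120, 00012], [⟨0, -2, 0, 0, -1⟩], [47], none⟩,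
   ⟨[01110, 00120, 00012], [⟨1, 2, -4, 2, -1⟩], [46], some (74, 02134)⟩,
   ⟨[01101, 00120, 00012], [⟨0, -2, 0, -1, 0⟩], [45], none⟩,
   ⟨[00111, 00012], [⟨1, -1, -1, 2, -1⟩, ⟨1, -1, 0, 0, 0⟩], [0, 1, 2, 3, 4, 42], some (7, 01234)⟩,
   ⟨[01011, 00111, 00012], [⟨1, -1, -1, 2, -1⟩], [43], some (80, 01234)⟩,
   ⟨[04000, 00111, 00012], [⟨0, 0, -1, 2, -1⟩], [41], some (61, 34012)⟩,
   ⟨[03000, 00111, 00012], [⟨0, 0, 1, -2, 1⟩], [41], some (41, 34012)⟩,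
   ⟨[02001, 00111, 00012], [⟨1, -1, 2, -4, 2⟩], [40], some (74, 04213)⟩,
   ⟨[01002, 00111, 00012], [⟨2, -2, 1, -2, 1⟩], [39], some (73, 02134)⟩,
   ⟨[00003], [⟨0, -1, -2, -2, -1⟩], [0, 3, 4, 8, 14, 19, 25, 31], none⟩,
   ⟨[01200, 00003], [⟨1, 0, 1, 0, 1⟩], [0, 1, 5, 14, 21, 33], none⟩,
   ⟨[02010, 01200, 00003], [⟨0, 0, -1, -2, 0⟩], [36], none⟩,
   ⟨[01011, 01200, 00003], [⟨0, 0, -1, -2, 0⟩], [35], none⟩,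
   ⟨[01110, 00003], [⟨0, -1, 1, 0, 0⟩, ⟨0, 0, 1, -1, 0⟩], [2, 7, 14, 19, 25, 31], some (3, 30124)⟩,
   ⟨[01020, 00003], [⟨1, 0, 0, 1, 1⟩], [0, 1, 2, 7, 12, 27], none⟩,
   ⟨[02100, 01020, 00003], [⟨0, 0, -2, -1, 0⟩], [32], none⟩,
   ⟨[01110, 01020, 00003], [⟨0, -2, 1, 1, 0⟩], [31], some (41, 31024)⟩,
   ⟨[01101, 01020, 00003], [⟨0, 0, -2, -1, 0⟩], [30], none⟩,
   ⟨[00210, 00003], [⟨1, 0, 1, -2, 0⟩, ⟨1, 1, 2, 0, 2⟩], [0, 1, 2, 3, 4, 27], none⟩,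
   ⟨[03000, 00210, 00003], [⟨1, 0, 1, -2, 0⟩], [28], some (32, 03214)⟩,
   ⟨[20020, 00210, 00003], [⟨1, 0, 1, 0, 1⟩], [27], none⟩,
   ⟨[01110, 00210, 00003], [⟨0, 1, 1, -2, 0⟩], [26], some (41, 30214)⟩,
   ⟨[01020, 00210, 00003], [⟨0, -2, -1, 0, 0⟩], [25], none⟩,
   ⟨[01011, 00210, 00003], [⟨0, -2, -1, 0, 0⟩], [24], none⟩,
   ⟨[00201, 00003], [⟨1, 0, 0, -1, 0⟩, ⟨1, 1, 2, 0, 2⟩], [0, 1, 2, 3, 21], none⟩,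
   ⟨[03000, 00201, 00003], [⟨1, 0, 0, -1, 0⟩], [22], some (29, 02314)⟩,
   ⟨[02010, 00201, 00003], [⟨1, 1, 0, -2, 0⟩], [21], some (32, 02314)⟩,
   ⟨[01020, 00201, 00003], [⟨1, -2, 0, 1, 0⟩], [20], some (32, 01324)⟩,
   ⟨[01011, 00201, 00003], [⟨0, 1, 0, -1, 0⟩], [19], some (30, 20314)⟩,
   ⟨[00120, 00003], [⟨1, 0, -2, 1, 0⟩, ⟨1, 1, 0, 2, 2⟩], [0, 1, 2, 3, 4, 16], none⟩,
   ⟨[03000, 00120, 00003], [⟨1, 0, -2, 1, 0⟩], [17], some (32, 03124)⟩,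
   ⟨[20200, 00120, 00003], [⟨1, 0, 0, 1, 1⟩], [16], none⟩,
   ⟨[01200, 00120, 00003], [⟨0, -2, 0, -1, 0⟩], [15], none⟩,
   ⟨[01110, 00120, 00003], [⟨0, 1, -2, 1, 0⟩], [14], some (41, 30124)⟩,
   ⟨[01101, 00120, 00003], [⟨0, -2, 0, -1, 0⟩], [13], none⟩,
   ⟨[00111, 00003], [⟨1, 1, 1, 1, 2⟩], [0, 1, 2, 3, 4, 10], none⟩,
   ⟨[02100, 00111, 00003], [⟨0, -1, 0, -2, 0⟩], [11], none⟩,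
   ⟨[02010, 00111, 00003], [⟨0, -1, -2, 0, 0⟩], [10], none⟩,
   ⟨[01200, 00111, 00003], [⟨1, 0, 1, 0, 1⟩], [9], none⟩,
   ⟨[01110, 00111, 00003], [⟨0, 0, 1, -1, 0⟩], [8], some (30, 23014)⟩,
   ⟨[01020, 00111, 00003], [⟨1, 0, 0, 1, 1⟩], [7], none⟩,
   ⟨[00021, 00003], [⟨1, 0, -1, 0, 0⟩, ⟨1, 1, 0, 2, 2⟩], [0, 1, 2, 3, 4], none⟩,
   ⟨[03000, 00021, 00003], [⟨1, 0, -1, 0, 0⟩], [5], some (29, 02134)⟩,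
   ⟨[02100, 00021, 00003], [⟨1, 1, -2, 0, 0⟩], [4], some (32, 02134)⟩,
   ⟨[01200, 00021, 00003], [⟨1, -2, 1, 0, 0⟩], [3], some (32, 01234)⟩,
   ⟨[01101, 00021, 00003], [⟨0, -1, 1, 0, 0⟩], [2], some (30, 20134)⟩,
   ⟨[00102, 00021, 00003], [⟨1, -1, 0, 0, 0⟩], [0, 1], some (29, 01234)⟩,
   ⟨[04000, 00102, 00021, 00003], [], [], some (122, 01234)⟩,
   ⟨[01002, 00102, 00021, 00003], [], [], some (121, 01234)⟩]

/-- The search; every node comes before those to which it leads. -/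
def nodes : List Node := nodes₁ ++ nodes₂ ++ nodes₃ ++ nodes₄ ++ nodes₅ ++ nodes₆

/-- Each index `k` of a representative of the orbits of the symmetric group on the sets `ℬᵢ`, with the
pairs of an index `i` and the digits of a rotation or mirror `r` such that `r(ℬᵢ)` is equivalent to
`c(ℬₖ)`, for the `c` in `cosetDigits`. -/
def classTable : List (ℕ × List (ℕ × ℕ)) := [
  (1, [(1, 21043), (1, 21043), (2, 10432), (1, 10432), (2, 10432), (1, 10432), (1, 21043), (1, 21043), (2, 10432), (2, 10432), (2, 32104), (2, 32104)]),
  (3, [(3, 01234), (3, 21043), (4, 01234), (3, 12340), (4, 10432), (3, 10432), (3, 01234), (3, 21043), (4, 01234), (4, 10432), (4, 32104), (4, 32104)]),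
  (5, [(5, 21043), (5, 21043), (6, 10432), (5, 10432), (6, 10432), (5, 10432), (5, 21043), (5, 21043), (6, 10432), (6, 10432), (6, 32104), (6, 32104)]),
  (7, [(7, 10432), (16, 21043), (16, 12340), (16, 12340), (16, 21043), (7, 10432), (9, 01234), (9, 21043), (9, 04321), (26, 34012), (26, 32104), (9, 23401)]),
  (8, [(8, 01234), (10, 21043), (18, 01234), (10, 12340), (18, 10432), (8, 10432), (13, 01234), (13, 21043), (24, 01234), (21, 23401), (21, 01234), (24, 32104)]),
  (11, [(11, 01234), (12, 21043), (23, 01234), (15, 12340), (27, 10432), (17, 10432), (14, 04321), (11, 04321), (25, 04321), (23, 04321), (15, 12340), (17, 10432)]),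
  (19, [(19, 01234), (20, 10432), (19, 01234), (20, 10432), (19, 10432), (19, 10432), (22, 01234), (22, 21043), (28, 34012), (22, 23401), (22, 01234), (28, 34012)]),
  (29, [(29, 10432), (29, 10432), (29, 10432), (29, 10432), (29, 10432), (29, 10432), (31, 21043), (31, 21043), (31, 23401), (31, 23401), (31, 21043), (31, 23401)]),
  (30, [(30, 01234), (30, 01234), (36, 10432), (30, 10432), (36, 10432), (30, 10432), (33, 21043), (33, 21043), (38, 23401), (38, 23401), (38, 01234), (38, 04321)]),
  (32, [(32, 01234), (32, 01234), (44, 01234), (35, 12340), (44, 01234), (35, 12340), (34, 01234), (34, 01234), (46, 01234), (46, 01234), (45, 32104), (45, 34012)]),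
  (37, [(37, 01234), (40, 21043), (37, 01234), (40, 21043), (37, 10432), (37, 10432), (39, 01234), (39, 21043), (52, 32104), (39, 23401), (39, 01234), (52, 32104)]),
  (41, [(41, 01234), (41, 21043), (50, 32104), (42, 12340), (54, 10432), (43, 10432), (42, 01234), (43, 21043), (53, 01234), (53, 10432), (50, 01234), (54, 32104)]),
  (47, [(47, 01234), (58, 21043), (48, 01234), (55, 21043), (47, 10432), (48, 10432), (51, 32104), (56, 21043), (49, 32104), (51, 10432), (56, 01234), (57, 32104)]),
  (59, [(59, 10432), (59, 10432), (59, 10432), (59, 10432), (59, 10432), (59, 10432), (60, 21043), (60, 21043), (60, 23401), (60, 23401), (60, 21043), (60, 23401)]),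
  (61, [(61, 21043), (61, 21043), (63, 01234), (62, 12340), (63, 01234), (62, 12340), (62, 01234), (62, 01234), (64, 10432), (64, 10432), (63, 32104), (63, 34012)]),
  (65, [(65, 01234), (71, 21043), (66, 01234), (68, 21043), (65, 10432), (66, 10432), (67, 01234), (70, 21043), (69, 32104), (67, 23401), (70, 01234), (72, 32104)]),
  (73, [(73, 04321), (79, 04321), (73, 04321), (79, 04321), (77, 10432), (77, 10432), (79, 01234), (99, 21043), (77, 12340), (99, 21043), (79, 01234), (77, 12340)]),
  (74, [(74, 01234), (83, 12340), (74, 01234), (83, 12340), (76, 10432), (76, 10432), (81, 04321), (90, 04321), (92, 10432), (90, 01234), (81, 04321), (92, 10432)]),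
  (75, [(75, 01234), (89, 12340), (75, 01234), (89, 12340), (78, 10432), (78, 10432), (88, 01234), (103, 21043), (112, 10432), (103, 23401), (88, 01234), (112, 10432)]),
  (80, [(80, 01234), (94, 21043), (80, 04321), (80, 04321), (94, 21043), (80, 01234), (80, 01234), (94, 21043), (80, 04321), (94, 21043), (94, 23401), (94, 23401)]),
  (82, [(82, 01234), (102, 43210), (93, 10432), (110, 12340), (91, 01234), (84, 10432), (104, 01234), (105, 21043), (109, 23401), (120, 32104), (118, 12340), (86, 04321)]),
  (85, [(85, 01234), (101, 21043), (98, 43210), (97, 43210), (108, 43210), (87, 10432), (106, 01234), (100, 21043), (119, 23401), (114, 40123), (115, 43210), (117, 34012)]),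
  (95, [(95, 01234), (107, 21043), (113, 34012), (96, 12340), (111, 34012), (96, 10432), (95, 01234), (107, 21043), (113, 34012), (111, 34012), (116, 21043), (116, 21043)]),
  (121, [(121, 04321), (121, 04321), (121, 04321), (121, 04321), (121, 04321), (121, 04321), (121, 04321), (121, 04321), (121, 04321), (121, 04321), (121, 04321), (121, 04321)]),
  (122, [(122, 10432), (122, 10432), (122, 10432), (122, 10432), (122, 10432), (122, 10432), (129, 21043), (129, 21043), (129, 23401), (129, 23401), (129, 21043), (129, 23401)]),
  (123, [(123, 01234), (123, 01234), (138, 01234), (124, 10432), (138, 01234), (124, 10432), (130, 21043), (130, 21043), (143, 23401), (143, 23401), (140, 01234), (140, 04321)]),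
  (125, [(125, 01234), (125, 01234), (144, 01234), (126, 10432), (144, 01234), (126, 10432), (125, 01234), (125, 01234), (144, 01234), (144, 01234), (149, 04321), (149, 04321)]),
  (127, [(127, 01234), (127, 01234), (164, 01234), (128, 10432), (164, 01234), (128, 10432), (135, 01234), (135, 01234), (169, 23401), (169, 23401), (167, 01234), (167, 04321)]),
  (131, [(131, 01234), (131, 01234), (171, 01234), (132, 10432), (171, 01234), (132, 10432), (136, 01234), (136, 01234), (179, 23401), (179, 23401), (174, 01234), (174, 04321)]),
  (133, [(133, 01234), (133, 01234), (194, 01234), (134, 10432), (194, 01234), (134, 10432), (137, 01234), (137, 01234), (206, 23401), (206, 23401), (197, 01234), (197, 04321)]),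
  (139, [(139, 01234), (142, 21043), (139, 01234), (142, 21043), (139, 10432), (139, 10432), (141, 01234), (141, 21043), (232, 32104), (141, 23401), (141, 01234), (232, 32104)]),
  (145, [(145, 01234), (151, 21043), (225, 01234), (148, 12340), (170, 23401), (146, 10432), (147, 01234), (150, 21043), (165, 01234), (166, 10432), (233, 01234), (168, 01234)]),
  (152, [(152, 01234), (156, 21043), (188, 32104), (158, 12340), (234, 10432), (153, 10432), (159, 01234), (157, 21043), (184, 32104), (258, 10432), (180, 32104), (181, 32104)]),
  (154, [(154, 01234), (161, 21043), (249, 32104), (162, 12340), (251, 10432), (155, 10432), (160, 01234), (163, 21043), (257, 01234), (259, 10432), (255, 01234), (248, 01234)]),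
  (172, [(172, 01234), (186, 21043), (191, 01234), (177, 12340), (190, 10432), (173, 10432), (175, 01234), (182, 21043), (240, 01234), (192, 23401), (193, 01234), (261, 01234)]),
  (176, [(176, 01234), (185, 21043), (241, 01234), (189, 12340), (242, 10432), (178, 10432), (183, 01234), (187, 21043), (262, 01234), (263, 10432), (254, 01234), (247, 01234)]),
  (195, [(195, 01234), (208, 21043), (209, 01234), (203, 12340), (210, 10432), (196, 10432), (200, 01234), (207, 21043), (236, 01234), (212, 23401), (211, 01234), (256, 01234)]),
  (198, [(198, 01234), (205, 21043), (246, 32104), (202, 12340), (250, 10432), (199, 10432), (201, 01234), (204, 21043), (235, 01234), (237, 10432), (227, 01234), (226, 01234)]),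
  (213, [(213, 01234), (218, 21043), (228, 01234), (216, 12340), (229, 10432), (214, 10432), (215, 01234), (217, 21043), (238, 01234), (239, 10432), (245, 01234), (253, 01234)]),
  (219, [(219, 01234), (224, 21043), (230, 01234), (222, 12340), (231, 10432), (220, 10432), (221, 01234), (223, 21043), (243, 01234), (244, 10432), (252, 01234), (260, 01234)]),
  (264, [(264, 10432), (264, 10432), (264, 10432), (264, 10432), (264, 10432), (264, 10432), (265, 21043), (265, 21043), (265, 23401), (265, 23401), (265, 21043), (265, 23401)]),
  (266, [(266, 01234), (275, 21043), (285, 01234), (269, 12340), (284, 10432), (267, 10432), (268, 01234), (274, 21043), (300, 01234), (286, 23401), (287, 01234), (308, 01234)]),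
  (270, [(270, 01234), (281, 21043), (301, 01234), (283, 12340), (302, 10432), (271, 10432), (276, 01234), (279, 21043), (310, 32104), (312, 10432), (311, 32104), (307, 01234)]),
  (272, [(272, 01234), (278, 21043), (289, 01234), (282, 12340), (290, 10432), (273, 10432), (277, 01234), (280, 21043), (309, 32104), (291, 23401), (288, 01234), (303, 01234)]),
  (292, [(292, 01234), (297, 21043), (298, 32104), (295, 12340), (299, 23401), (293, 10432), (294, 01234), (296, 21043), (313, 32104), (306, 23401), (304, 32104), (305, 32104)]),
  (314, [(314, 04321), (316, 04321), (314, 04321), (316, 04321), (315, 10432), (315, 10432), (316, 01234), (317, 21043), (315, 12340), (317, 21043), (316, 01234), (315, 12340)]),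
  (318, [(318, 01234), (320, 21043), (321, 01234), (319, 12340), (322, 10432), (319, 10432), (318, 01234), (320, 21043), (321, 01234), (322, 10432), (323, 01234), (323, 01234)]),
  (324, [(324, 01234), (329, 21043), (330, 01234), (327, 12340), (331, 10432), (325, 10432), (326, 01234), (328, 21043), (334, 01234), (333, 23401), (332, 01234), (335, 01234)]),
  (336, [(336, 01234), (351, 43210), (346, 10432), (350, 43210), (345, 01234), (337, 10432), (356, 01234), (362, 21043), (364, 23401), (367, 04321), (369, 21043), (343, 04321)]),
  (338, [(338, 01234), (360, 43210), (349, 10432), (358, 12340), (348, 43210), (339, 10432), (357, 01234), (363, 21043), (365, 23401), (368, 12340), (371, 21043), (344, 04321)]),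
  (340, [(340, 01234), (347, 23401), (355, 10432), (366, 12340), (352, 01234), (342, 10432), (354, 04321), (361, 21043), (359, 23401), (370, 43210), (353, 12340), (341, 04321)])]

theorem nodesOk_nodes : nodesOk (classTable.map Prod.fst) nodes = true := by
  decide +kernel

/-! ### Orbits of the symmetric group and of the dihedral group -/

def sameOrth (U V : List IntVec) : Bool :=
  forceList U fun U => forceList V fun V =>
    (forceList (nullGens U) fun G => allOrth G V) && forceList (nullGens V) fun G => allOrth G U

theorem isOrth_iff_of_sameOrth {U V : List IntVec} (h : sameOrth U V = true) (β : Fin 5 → ℝ) :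
    IsOrth U β ↔ IsOrth V β := by
  simp only [sameOrth, forceList_eq, Bool.and_eq_true] at h
  exact ⟨fun hU => isOrth_of_mem_linSpan h.1 hU.mem_linSpan,
    fun hV => isOrth_of_mem_linSpan h.2 hV.mem_linSpan⟩

/-- The digits of the rotations and reflections of the pentagon. -/
def dihedralDigits : List ℕ :=
  [01234, 04321, 12340, 10432, 23401, 21043, 34012, 32104, 40123, 43210]

/-- The digits of representatives of the cosets of the dihedral group. -/
def cosetDigits : List ℕ :=
  [01234, 01243, 01324, 01342, 01423, 01432, 02134, 02143, 02314, 02413, 03124, 03214]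

/-- The 120 permutations are the 12 · 10 products c ∘ r. The dihedral factor is applied to positions
first, so these are left cosets. -/
theorem exists_cosetDigits_dihedralDigits : ∀ ρ : Equiv.Perm (Fin 5),
    ∃ c ∈ cosetDigits, ∃ r ∈ dihedralDigits, ∀ i, ρ i = digitFun c (digitFun r i) := by
  decide +kernel

theorem injective_digitFun_of_mem_cosetDigits :
    ∀ c ∈ cosetDigits, Function.Injective (digitFun c) := by
  decide +kernel

/-- The normal form "power of the rotation times power of the mirror" shows that the ten listed
permutations lie in the generated subgroup. -/
theorem exists_rotation_mirror : ∀ r ∈ dihedralDigits, ∃ k : Fin 5, ∃ e : Fin 2, ∀ i : Fin 5,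
    (finRotate 5 ^ (k : ℕ) * (Equiv.swap 1 3 * Equiv.swap 0 4) ^ (e : ℕ) : Equiv.Perm (Fin 5)) i =
      digitFun r i := by
  decide +kernel

theorem exists_mem_rotationMirror {r : ℕ} (hr : r ∈ dihedralDigits) :
    ∃ s ∈ rotationMirror, ⇑s = digitFun r := by
  obtain ⟨k, e, h⟩ := exists_rotation_mirror r hr
  exact ⟨_, mul_mem (pow_mem (Subgroup.subset_closure (by simp)) _)
    (pow_mem (Subgroup.subset_closure (by simp)) _), funext h⟩

/-- The orbit of `ℬₖ` under the coset representatives consists, up to orthogonal complements, of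
the listed images of sets `ℬᵢ` under the dihedral group. -/
def orbitOk (x : ℕ × List (ℕ × ℕ)) : Bool :=
  -- `zip` truncates to the shorter list, so equal lengths are needed for every coset representative
  -- to be covered.
  cosetDigits.length == x.2.length &&
  (cosetDigits.zip x.2).all fun y =>
    decide (1 ≤ y.2.1 ∧ y.2.1 ≤ 371 ∧ y.2.2 ∈ dihedralDigits) &&
      sameOrth ((tableVecs x.1).map (IntVec.permute y.1))
        ((tableVecs y.2.1).map (IntVec.permute y.2.2))

theorem orbitOk_classTable : classTable.all orbitOk = true := by
  decide +kernel

theorem exists_sameOrth {k c : ℕ} (hk : k ∈ classTable.map Prod.fst) (hc : c ∈ cosetDigits) :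
    ∃ i, 1 ≤ i ∧ i ≤ 371 ∧ ∃ r ∈ dihedralDigits,
      ∀ β, IsOrth ((tableVecs k).map (IntVec.permute c)) β ↔
        IsOrth ((tableVecs i).map (IntVec.permute r)) β := by
  obtain ⟨x, hx, rfl⟩ := List.mem_map.1 hk
  have h := List.all_eq_true.1 orbitOk_classTable x hx
  rw [orbitOk, Bool.and_eq_true, beq_iff_eq, List.all_eq_true] at h
  obtain ⟨n, hn, rfl⟩ := List.getElem_of_mem hc
  have hn' : n < (cosetDigits.zip x.2).length := by
    rw [List.length_zip, ← h.1, min_self]; exact hn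
  have h2 := h.2 _ (List.getElem_mem hn')
  rw [List.getElem_zip, Bool.and_eq_true, decide_eq_true_iff] at h2
  exact ⟨_, h2.1.1, h2.1.2.1, _, h2.1.2.2, isOrth_iff_of_sameOrth h2.2⟩

theorem excess_permVec_dotProduct (ρ : Equiv.Perm (Fin 5)) (w : Fin 5 → ℕ) (β : Fin 5 → ℝ) :
    excess (permVec ρ w) ⬝ᵥ β = excess w ⬝ᵥ (β ∘ ρ.symm) :=
  comp_equiv_dotProduct_comp_equiv (excess w) (β ∘ ρ.symm) ρ ▸ by
    congr 1; ext i; simp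

theorem isPerp_image_permVec (ρ : Equiv.Perm (Fin 5)) (X : Set (Fin 5 → ℕ)) (β : Fin 5 → ℝ) :
    IsPerp (permVec ρ '' X) β ↔ IsPerp X (β ∘ ρ.symm) := by
  simp only [IsPerp, Set.forall_mem_image, excess_permVec_dotProduct]

theorem isOrth_map_permute {n : ℕ} {ρ : Equiv.Perm (Fin 5)} (h : ⇑ρ = digitFun n)
    (V : List IntVec) (β : Fin 5 → ℝ) :
    IsOrth (V.map (IntVec.permute n)) β ↔ IsOrth V (β ∘ ρ.symm) := by
  simp only [IsOrth, List.forall_mem_map, IntVec.toReal_permute, ← h]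
  refine forall₂_congr fun v _ => ?_
  rw [← comp_equiv_dotProduct_comp_equiv v.toReal (β ∘ ρ.symm) ρ, Function.comp_assoc,
    Equiv.symm_comp_self, Function.comp_id]

theorem exists_perm_eq_digitFun {n : ℕ} (h : Function.Injective (digitFun n)) :
    ∃ ρ : Equiv.Perm (Fin 5), ⇑ρ = digitFun n :=
  ⟨Equiv.ofBijective _ (Finite.injective_iff_bijective.1 h), rfl⟩

/-- Up to orthogonal complements, all images of the representatives `ℬₖ` under permutations are
images of the `ℬᵢ` under rotations and mirrors. -/
theorem exists_rotationMirror_isPerp_iff {k : ℕ} (hk : k ∈ classTable.map Prod.fst)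
    (ρ : Equiv.Perm (Fin 5)) :
    ∃ i, 1 ≤ i ∧ i ≤ 371 ∧ ∃ r ∈ rotationMirror,
      ∀ β, IsPerp (B k) (β ∘ ρ.symm) ↔ IsPerp (permVec r '' B i) β := by
  obtain ⟨c, hc, d, hd, hρ⟩ := exists_cosetDigits_dihedralDigits ρ
  obtain ⟨i, h1, h371, e, he, h⟩ := exists_sameOrth hk hc
  obtain ⟨γ, hγ⟩ := exists_perm_eq_digitFun (injective_digitFun_of_mem_cosetDigits c hc)
  obtain ⟨s, hs, hsd⟩ := exists_mem_rotationMirror hd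
  obtain ⟨r, hr, hre⟩ := exists_mem_rotationMirror he
  have hρ' : ρ = γ * s := by
    ext j; rw [hρ, Equiv.Perm.mul_apply, hγ, hsd]
  -- `permVec` reverses products: ρ = γ * s acts as γ followed by s. Replacing γ(ℬₖ) by the
  -- equivalent r(ℬᵢ) and then applying s gives the action of r * s.
  refine ⟨i, h1, h371, r * s, mul_mem hr hs, fun β => ?_⟩
  have := h (β ∘ s.symm)
  rw [isOrth_map_permute hγ, isOrth_map_permute hre, ← isPerp_B, ← isPerp_B] at this
  rw [isPerp_image_permVec, hρ']
  exact this

/-! ### Angle polytopes -/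

theorem sum_eq_two_iff {α : Fin 5 → ℝ} (hα : ∑ i, α i = 3) (w : Fin 5 → ℕ) :
    ∑ i, α i * (w i : ℝ) = 2 ↔ excess w ⬝ᵥ α = 0 := by
  simp only [Fin.sum_univ_five, dotProduct, excess] at *
  constructor <;> intro h <;> linarith

theorem mem_anglePolytope_iff {X : Set (Fin 5 → ℕ)} {α : Fin 5 → ℝ} :
    α ∈ anglePolytope X ↔ (∀ i, 0 ≤ α i ∧ α i ≤ 1) ∧ ∑ i, α i = 3 ∧ IsPerp X α :=
  and_congr_right fun _ => and_congr_right fun hα => forall₂_congr fun w _ => sum_eq_two_iff hα w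

/-- The linear form (x, s) ↦ γ·x − s vanishes on the spanning vectors, hence on the span. -/
theorem dotProduct_eq_two_of_mem_Compat {V : Set (Fin 5 → ℕ)} {γ : Fin 5 → ℝ}
    (hγ : ∑ i, γ i = 3) (hV : ∀ v ∈ V, ∑ i, γ i * (v i : ℝ) = 2) {w : Fin 5 → ℕ}
    (hw : w ∈ Compat V) : ∑ i, γ i * (w i : ℝ) = 2 := by
  have key : ∀ x ∈ Submodule.span ℝ (insert ((fun _ => 1, 3) : (Fin 5 → ℝ) × ℝ) (lift '' V)),
      γ ⬝ᵥ x.1 = x.2 := by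
    intro x hx
    induction hx using Submodule.span_induction with
    | mem x hx =>
      rcases hx with rfl | ⟨v, hv, rfl⟩
      · simpa [dotProduct] using hγ
      · exact hV v hv
    | zero => simp
    | add x y _ _ hx hy => rw [Prod.fst_add, Prod.snd_add, dotProduct_add, hx, hy]
    | smul t x _ hx => rw [Prod.smul_fst, Prod.smul_snd, dotProduct_smul, hx]
  exact key _ hw

theorem subset_Compat (V : Set (Fin 5 → ℕ)) : V ⊆ Compat V := fun v hv =>
  Submodule.subset_span (Set.mem_insert_of_mem _ ⟨v, hv, rfl⟩)

theorem isPerp_Compat_iff {V : Set (Fin 5 → ℕ)} {γ : Fin 5 → ℝ} (hγ : ∑ i, γ i = 3) :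
    IsPerp (Compat V) γ ↔ IsPerp V γ := by
  simp only [IsPerp, ← sum_eq_two_iff hγ]
  exact ⟨fun h v hv => h v (subset_Compat V hv), fun h _ hw =>
    dotProduct_eq_two_of_mem_Compat hγ h hw⟩

theorem anglePolytope_image_Compat (r : Equiv.Perm (Fin 5)) (V : Set (Fin 5 → ℕ)) :
    anglePolytope (permVec r '' Compat V) = anglePolytope (permVec r '' V) := by
  ext α
  rw [mem_anglePolytope_iff, mem_anglePolytope_iff]
  refine and_congr_right fun _ => and_congr_right fun hα => ?_
  rw [isPerp_image_permVec, isPerp_image_permVec]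
  exact isPerp_Compat_iff ((Equiv.sum_comp r.symm α).trans hα)

/-- Apply goodness to u = y − (∑ y / 3) α, which has coordinate sum 0. As α·w = 2 on 𝒳, the product
of y with the excess of w is 3 (u·w). Only the negative half of goodness is kept; the positive half
is the same statement for −y. -/
theorem exists_dotProduct_neg {X : Set (Fin 5 → ℕ)} (hgood : IsGood X) {α : Fin 5 → ℝ}
    (hα : ∑ i, α i = 3) (hperp : IsPerp X α) (y : Fin 5 → ℝ) :
    IsPerp X y ∨ ∃ w ∈ X, excess w ⬝ᵥ y < 0 := by
  have hu : ∑ i, (y - ((∑ j, y j) / 3) • α) i = 0 := by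
    simp only [Pi.sub_apply, Pi.smul_apply, smul_eq_mul, Finset.sum_sub_distrib, ← Finset.mul_sum,
      hα]
    ring
  have key : ∀ w ∈ X, excess w ⬝ᵥ y = 3 * ∑ i, (y - ((∑ j, y j) / 3) • α) i * (w i : ℝ) := by
    intro w hw
    have h := (sum_eq_two_iff hα w).2 (hperp w hw)
    simp only [Fin.sum_univ_five, dotProduct, excess, Pi.sub_apply, Pi.smul_apply,
      smul_eq_mul] at *
    linear_combination (y 0 + y 1 + y 2 + y 3 + y 4) * h
  rcases hgood _ hu with h | ⟨w, hw, -, -, h, -⟩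
  · exact .inl fun w hw => by rw [key w hw, h w hw, mul_zero]
  · exact .inr ⟨w, hw, by rw [key w hw]; linarith⟩

/-- After sorting the angles, `X` becomes admissible. -/
theorem admissible_image_sort {X : Set (Fin 5 → ℕ)} (hne : X.Nonempty) (hgood : IsGood X)
    {α : Fin 5 → ℝ} (hα : α ∈ anglePolytope X) (hint : ∀ i, 0 < α i ∧ α i < 1) :
    Admissible (permVec (Tuple.sort α) '' X) (α ∘ Tuple.sort α) := by
  obtain ⟨-, hsum, hperp⟩ := mem_anglePolytope_iff.1 hα
  have hcomp : ∀ β : Fin 5 → ℝ, (β ∘ Tuple.sort α) ∘ (Tuple.sort α).symm = β := fun β => by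
    rw [Function.comp_assoc, Equiv.self_comp_symm, Function.comp_id]
  refine ⟨hne.image _, fun y => ?_, ?_, (Equiv.sum_comp _ α).trans hsum, fun i => hint _,
    Tuple.monotone_sort α⟩
  · simp only [isPerp_image_permVec, Set.exists_mem_image, excess_permVec_dotProduct]
    exact exists_dotProduct_neg hgood hsum hperp _
  · rwa [isPerp_image_permVec, hcomp]

/-- The first node is the root, whose list of known vectors is empty, so being settled imposes no
condition beyond admissibility. The default of `headD` is never reached. -/
theorem settled_nil : Settled (classTable.map Prod.fst) [] :=
  settled_of_nodesOk nodesOk_nodes (nodes₁.headD ⟨[], [], [], none⟩)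
    (List.mem_append_left _ (List.mem_append_left _ (List.mem_append_left _
      (List.mem_append_left _ (List.mem_append_left _ List.mem_cons_self)))))

/-- A good set with an interior angle vector has the orthogonal complement of a rotated or
mirrored `ℬᵢ`. -/
theorem exists_isPerp_iff {X : Set (Fin 5 → ℕ)} (hne : X.Nonempty) (hgood : IsGood X)
    {α : Fin 5 → ℝ} (hα : α ∈ anglePolytope X) (hint : ∀ i, 0 < α i ∧ α i < 1) :
    ∃ i, 1 ≤ i ∧ i ≤ 371 ∧ ∃ r ∈ rotationMirror,
      ∀ β, IsPerp X β ↔ IsPerp (permVec r '' B i) β := by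
  obtain ⟨k, hk, p, hp, h⟩ := settled_nil _ _ (admissible_image_sort hne hgood hα hint)
    fun _ _ _ hv => (List.not_mem_nil hv).elim
  obtain ⟨τ, hτ⟩ := exists_perm_eq_digitFun hp
  -- The sorted set is equivalent to τ(ℬₖ), so undoing the sorting leaves the single permutation τ *
  -- (sort)⁻¹ applied to ℬₖ.
  obtain ⟨i, h1, h371, r, hr, hB⟩ := exists_rotationMirror_isPerp_iff hk (τ * (Tuple.sort α)⁻¹)
  refine ⟨i, h1, h371, r, hr, fun β => ?_⟩
  have := h (β ∘ Tuple.sort α)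
  rw [isPerp_image_permVec, isOrth_map_permute hτ, ← isPerp_B, Function.comp_assoc,
    Equiv.self_comp_symm, Function.comp_id] at this
  rw [this, ← hB]
  rfl

end Pentagon

theorem lemma3p1 (X : Set (Fin 5 → ℕ)) (hne : X.Nonempty) (hgood : Pentagon.IsGood X)
    (hint : ∃ α ∈ Pentagon.anglePolytope X, ∀ i, 0 < α i ∧ α i < 1) :
    ∃ i : ℕ, 1 ≤ i ∧ i ≤ 371 ∧ ∃ r ∈ Pentagon.rotationMirror,
      Pentagon.anglePolytope X =
        Pentagon.anglePolytope (Pentagon.permVec r '' Pentagon.Compat (Pentagon.B i)) := by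
  obtain ⟨α, hα, hα'⟩ := hint
  obtain ⟨i, h1, h371, r, hr, h⟩ := Pentagon.exists_isPerp_iff hne hgood hα hα'
  refine ⟨i, h1, h371, r, hr, ?_⟩
  rw [Pentagon.anglePolytope_image_Compat]
  ext β
  rw [Pentagon.mem_anglePolytope_iff, Pentagon.mem_anglePolytope_iff, h]
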